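/- \textbf{Conventions.} Let $E$ be an Archimedean real vector lattice that is relatively uniformly complete: every sequence $(x_n)$ in $E$ for which there is $u\in E$ such that for each $\varepsilon>0$ one has $|x_n-x_m|\le\varepsilon u$ for all large $n,m$, converges relatively uniformly in $E$. Let $X=E+iE$ be its complexification, a complex vector lattice with modulus $|x+iy|=\sup_{0\le\theta<2\pi}|\cos(\theta)x+\sin(\theta)y|\in E$ and positive cone $E_+$. A linear operator on $X$ is positive if it maps $E_+$ into $E_+$. A net $(x_\alpha)$ in $X$ \emph{ru-converges} to $x$ if there is $u\in E$ such that for each $\varepsilon>0$ there is $\alpha_0$ with $|x_\alpha-x|\le\varepsilon u$ for all $\alpha\ge\alpha_0$. A set $D\subset X$ is \emph{ru-dense} if every $x\in X$ is the ru-limit of a sequence in $D$. The space $X$ has \emph{property (D)} if a net $(T_\alpha)$ of linear operators on $X$ satisfies $T_\alpha x\to0$ relatively uniformly for every $x\in X$ whenever (a) there is an ru-dense $D\subset X$ such that $T_\alpha y$ ru-converges to $0$ for every $y\in D$, and (b) for every sequence $(x_n)$ that ru-converges to $0$ there is $u\in E_+$ such that for each $\varepsilon>0$ there are $N_\varepsilon$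 and $\alpha_\varepsilon$ with $|T_\alpha x_n|\le\varepsilon u$ for all $n\ge N_\varepsilon$, $\alpha\ge\alpha_\varepsilon$. A \emph{positive ru-continuous semigroup} is a family $(T(t))_{t\ge0}$ of positive linear operators on $X$ with $T(0)=I$, $T(s+t)=T(t)T(s)$, such that for each $x\in X$ there is $u:[0,\infty)\to E$ such that for each $\varepsilon>0$ there is $\delta>0$ with $|T(t+h)x-T(t)x|\le\varepsilon u(t)$ for all $t\ge0$ and $-\min\{\delta,t\}\le h\le\delta$. It is \emph{exponentially order bounded with order exponent $w\in\mathbb R$} if for each $x\in X$ there is $u\in E$ with $|T(t)x|\le e^{wt}u$ for all $t\ge0$. Its \emph{generator} is $Ax=\text{ru-}\lim_{h\searrow0}\frac1h(T(h)x-x)$, whose domain $D(A)$ is the set of all $x\in X$ for which this ru-limit exists. A linear operator $A:D(A)\subset X\to X$ is \emph{ru-densely defined} if $D(A)$ is ru-dense, and \emph{ru-closed} if for every sequence $(x_n)$ in $D(A)$ such that $x_n$ ru-converges to $x$ and $Ax_n$ ru-converges to $y$, one has $x\in D(A)$ and $Ax=y$. Put $\rho(A)=\{\lambda\in\mathbb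 C:\lambda-A:D(A)\to X\text{ is bijective}\}$, $R(\lambda,A)=(\lambda-A)^{-1}$ for $\lambda\in\rho(A)$, and let the \emph{positive resolvent set} be $\rho_+(A)=\{\lambda\in\rho(A): R(\lambda,A)\text{ is a positive operator}\}$. \textbf{Theorem (Hille--Yosida type theorem).} Let $X=E+iE$ be as above with property (D), and let $A:D(A)\subset X\to X$ be a linear operator. Then the following assertions are equivalent. (i) $A$ is the generator of a positive ru-continuous semigroup on $X$ that is exponentially order bounded with order exponent $0$. (ii) $A$ is ru-closed and ru-densely defined; every $\lambda\in\mathbb C$ with $\operatorname{Re}\lambda>0$ lies in $\rho(A)$; every real $\lambda>0$ lies in $\rho_+(A)$; and for each $x\in X$ there is $u\in E$ such that $|R(\lambda,A)^kx|\le(\operatorname{Re}\lambda)^{-k}u$ for all $k\in\mathbb N$ and all $\lambda\in\mathbb C$ with $\operatorname{Re}\lambda>0$. -/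

import Mathlib

open Filter Topology
open scoped NNReal

noncomputable section

namespace RUSemigroup

universe u

/-! ### Real vector lattices

A real vector lattice is an ordered real vector space whose order is a lattice. -/

/-- Archimedean vector lattices: `0 ≤ n x ≤ y` for all `n` forces `x = 0`. -/
class IsArchimedean (E : Type u) [AddCommGroup E] [Lattice E] : Prop where
  eq_zero : ∀ x y : E, (∀ n : ℕ, 0 ≤ n • x ∧ n • x ≤ y) → x = 0

/-- Relative uniform completeness: every relatively uniform Cauchy sequence converges relatively
uniformly. -/
class IsRUComplete (E : Type u) [AddCommGroup E] [Lattice E] [Module ℝ E] : Prop where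
  complete : ∀ x : ℕ → E,
    (∃ v : E, ∀ ε : ℝ, 0 < ε → ∃ N : ℕ, ∀ n ≥ N, ∀ m ≥ N, |x n - x m| ≤ ε • v) →
    ∃ (a v : E), ∀ ε : ℝ, 0 < ε → ∃ N : ℕ, ∀ n ≥ N, |x n - a| ≤ ε • v

section Real

variable {E : Type u} [AddCommGroup E] [Lattice E] [IsOrderedAddMonoid E] [Module ℝ E]
  [IsOrderedModule ℝ E]

theorem smul_le_abs_smul_abs (c : ℝ) (x : E) : c • x ≤ |c| • |x| := by
  rcases le_total 0 c with h | h
  · rw [abs_of_nonneg h]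
    exact smul_le_smul_of_nonneg_left (le_abs_self x) h
  · rw [abs_of_nonpos h, ← neg_smul_neg c x]
    exact smul_le_smul_of_nonneg_left (neg_le_abs x) (neg_nonneg.2 h)

theorem abs_smul_le (c : ℝ) (x : E) : |c • x| ≤ |c| • |x| := by
  refine abs_le'.2 ⟨smul_le_abs_smul_abs c x, ?_⟩
  rw [← neg_smul, ← abs_neg c]
  exact smul_le_abs_smul_abs (-c) x

theorem le_of_forall_le_add_smul [IsArchimedean E] {a b v : E}
    (h : ∀ ε : ℝ, 0 < ε → a ≤ b + ε • v) : a ≤ b := by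
  have key : (a - b) ⊔ 0 = 0 := by
    refine IsArchimedean.eq_zero _ (v ⊔ 0) fun n => ⟨nsmul_nonneg le_sup_right n, ?_⟩
    rcases Nat.eq_zero_or_pos n with rfl | hn
    · simp
    have hn' : (0 : ℝ) < n := by exact_mod_cast hn
    have h1 : (a - b) ⊔ 0 ≤ (n : ℝ)⁻¹ • (v ⊔ 0) := by
      refine sup_le ?_ (smul_nonneg (inv_nonneg.2 hn'.le) le_sup_right)
      have := h (n : ℝ)⁻¹ (inv_pos.2 hn')
      refine (sub_le_iff_le_add'.2 this).trans ?_
      exact smul_le_smul_of_nonneg_left le_sup_left (inv_nonneg.2 hn'.le)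
    have h2 := smul_le_smul_of_nonneg_left h1 hn'.le
    rwa [smul_smul, mul_inv_cancel₀ hn'.ne', one_smul, Nat.cast_smul_eq_nsmul] at h2
  have : a - b ≤ 0 := by rw [← key]; exact le_sup_left
  exact sub_nonpos.1 this

/-- The element `|cos θ • x + sin θ • y|` of the lattice. -/
def rotAbs (x y : E) (θ : ℝ) : E := |Real.cos θ • x + Real.sin θ • y|

theorem rotAbs_le (x y : E) (θ φ : ℝ) :
    rotAbs x y θ ≤ rotAbs x y φ + |θ - φ| • (|x| + |y|) := by
  have hx : |(Real.cos θ - Real.cos φ) • x| ≤ |θ - φ| • |x| :=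
    (abs_smul_le _ _).trans
      (smul_le_smul_of_nonneg_right (Real.abs_cos_sub_cos_le θ φ) (abs_nonneg x))
  have hy : |(Real.sin θ - Real.sin φ) • y| ≤ |θ - φ| • |y| :=
    (abs_smul_le _ _).trans
      (smul_le_smul_of_nonneg_right (Real.abs_sin_sub_sin_le θ φ) (abs_nonneg y))
  have e : Real.cos θ • x + Real.sin θ • y = (Real.cos φ • x + Real.sin φ • y)
      + ((Real.cos θ - Real.cos φ) • x + (Real.sin θ - Real.sin φ) • y) := by
    module
  unfold rotAbs
  rw [e, smul_add]
  exact (abs_add_le _ _).trans (add_le_add le_rfl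
    ((abs_add_le _ _).trans (add_le_add hx hy)))

/-- In an Archimedean, relatively uniformly complete vector lattice the supremum of
`|cos θ • x + sin θ • y|` over `0 ≤ θ < 2π` exists. -/
theorem exists_isLUB_rotAbs [IsArchimedean E] [IsRUComplete E] (x y : E) :
    ∃ m : E, IsLUB (rotAbs x y '' Set.Ico 0 (2 * Real.pi)) m := by
  set w : E := |x| + |y| with hw
  have hw0 : 0 ≤ w := add_nonneg (abs_nonneg x) (abs_nonneg y)
  have hpi := Real.two_pi_pos
  set c : ℕ → ℝ := fun n => 2 * Real.pi / (n + 1) with hc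
  have hcpos : ∀ n, 0 < c n := fun n => by positivity
  set s : ℕ → E := fun n => (Finset.range (n + 1)).sup' ⟨0, by simp⟩
    (fun k => rotAbs x y (k * c n)) with hs
  have hmem : ∀ n : ℕ, ∀ k ∈ Finset.range (n + 1),
      (k * c n : ℝ) ∈ Set.Ico 0 (2 * Real.pi) := by
    intro n k hk
    have hk' : (k : ℝ) < n + 1 := by exact_mod_cast Finset.mem_range.1 hk
    refine ⟨mul_nonneg (Nat.cast_nonneg k) (hcpos n).le, ?_⟩
    calc (k * c n : ℝ) < (n + 1) * c n := by gcongr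
      _ = 2 * Real.pi := by simp only [hc]; field_simp
  have hub : ∀ n : ℕ, ∀ θ ∈ Set.Ico 0 (2 * Real.pi), rotAbs x y θ ≤ s n + c n • w := by
    intro n θ hθ
    have h0 : 0 ≤ θ / c n := div_nonneg hθ.1 (hcpos n).le
    have hfl := Nat.floor_le h0
    have hlt := Nat.lt_floor_add_one (θ / c n)
    rw [le_div_iff₀ (hcpos n)] at hfl
    rw [div_lt_iff₀ (hcpos n)] at hlt
    have hk : ⌊θ / c n⌋₊ ∈ Finset.range (n + 1) := by
      rw [Finset.mem_range, Nat.floor_lt h0, div_lt_iff₀ (hcpos n)]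
      have : ((n + 1 : ℕ) : ℝ) * c n = 2 * Real.pi := by
        simp only [hc]; push_cast; field_simp
      rw [this]; exact hθ.2
    refine (rotAbs_le x y θ (⌊θ / c n⌋₊ * c n)).trans (add_le_add ?_ ?_)
    · exact Finset.le_sup' (fun k : ℕ => rotAbs x y (k * c n)) hk
    · refine smul_le_smul_of_nonneg_right ?_ hw0
      rw [abs_of_nonneg (by linarith)]
      linarith
  have hsle : ∀ m n : ℕ, s m ≤ s n + c n • w := fun m n =>
    Finset.sup'_le _ _ fun k hk => hub n _ (hmem m k hk)
  have hclim : ∀ ε : ℝ, 0 < ε → ∃ N : ℕ, ∀ n ≥ N, c n ≤ ε := by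
    intro ε hε
    obtain ⟨N, hN⟩ := exists_nat_gt (2 * Real.pi / ε)
    refine ⟨N, fun n hn => ?_⟩
    have hn' : (N : ℝ) ≤ n := by exact_mod_cast hn
    rw [div_lt_iff₀ hε] at hN
    simp only [hc]
    rw [div_le_iff₀ (by positivity)]
    nlinarith
  obtain ⟨m, v, hm⟩ := IsRUComplete.complete s ⟨w, fun ε hε => by
    obtain ⟨N, hN⟩ := hclim ε hε
    refine ⟨N, fun n hn k hk => abs_le'.2 ⟨?_, ?_⟩⟩
    · exact (sub_le_iff_le_add'.2 (hsle n k)).trans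
        (smul_le_smul_of_nonneg_right (hN k hk) hw0)
    · rw [neg_sub]
      exact (sub_le_iff_le_add'.2 (hsle k n)).trans
        (smul_le_smul_of_nonneg_right (hN n hn) hw0)⟩
  refine ⟨m, ?_, ?_⟩
  · rintro _ ⟨θ, hθ, rfl⟩
    refine le_of_forall_le_add_smul (v := v + w) fun ε hε => ?_
    obtain ⟨N₁, h₁⟩ := hclim ε hε
    obtain ⟨N₂, h₂⟩ := hm ε hε
    have a1 := hub (max N₁ N₂) θ hθ
    have a2 := sub_le_iff_le_add'.1
      ((le_abs_self _).trans (h₂ (max N₁ N₂) (le_max_right _ _)))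
    have a3 := smul_le_smul_of_nonneg_right (h₁ (max N₁ N₂) (le_max_left _ _)) hw0
    rw [smul_add, ← add_assoc]
    exact a1.trans (add_le_add a2 a3)
  · intro b hb
    refine le_of_forall_le_add_smul (v := v) fun ε hε => ?_
    obtain ⟨N, h⟩ := hm ε hε
    have a1 : s N ≤ b := Finset.sup'_le _ _ fun k hk => hb ⟨_, hmem N k hk, rfl⟩
    have a2 := (neg_le_abs _).trans (h N le_rfl)
    rw [neg_sub, sub_le_iff_le_add'] at a2
    exact a2.trans (add_le_add a1 le_rfl)

end Real

/-! ### Complex vector lattices -/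

/-- The complexification `E + iE` of a real vector lattice; `(x, y)` stands for `x + iy`. -/
def Complexification (E : Type u) : Type u := E × E

namespace Complexification

/-- The real part `x` of `x + iy`. -/
def re {E : Type u} (z : Complexification E) : E := z.1

/-- The imaginary part `y` of `x + iy`. -/
def im {E : Type u} (z : Complexification E) : E := z.2

/-- The element `x + iy`. -/
def mk {E : Type u} (x y : E) : Complexification E := (x, y)

@[simp] theorem re_mk {E : Type u} (x y : E) : (mk x y).re = x := rfl
@[simp] theorem im_mk {E : Type u} (x y : E) : (mk x y).im = y := rfl

@[ext] theorem ext {E : Type u} {z w : Complexification E} (h₁ : z.re = w.re)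
    (h₂ : z.im = w.im) : z = w := Prod.ext h₁ h₂

variable {E : Type u} [AddCommGroup E]

instance : AddCommGroup (Complexification E) := inferInstanceAs (AddCommGroup (E × E))

@[simp] theorem re_zero : (0 : Complexification E).re = 0 := rfl
@[simp] theorem im_zero : (0 : Complexification E).im = 0 := rfl
@[simp] theorem re_add (z w : Complexification E) : (z + w).re = z.re + w.re := rfl
@[simp] theorem im_add (z w : Complexification E) : (z + w).im = z.im + w.im := rfl
@[simp] theorem re_neg (z : Complexification E) : (-z).re = -z.re := rfl
@[simp] theorem im_neg (z : Complexification E) : (-z).im = -z.im := rfl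
@[simp] theorem re_sub (z w : Complexification E) : (z - w).re = z.re - w.re := rfl
@[simp] theorem im_sub (z w : Complexification E) : (z - w).im = z.im - w.im := rfl

variable [Module ℝ E]

/-- `(a + ib)(x + iy) = (ax - by) + i(ay + bx)`. -/
instance : SMul ℂ (Complexification E) :=
  ⟨fun c z => mk (c.re • z.re - c.im • z.im) (c.re • z.im + c.im • z.re)⟩

@[simp] theorem re_smul (c : ℂ) (z : Complexification E) :
    (c • z).re = c.re • z.re - c.im • z.im := rfl
@[simp] theorem im_smul (c : ℂ) (z : Complexification E) :
    (c • z).im = c.re • z.im + c.im • z.re := rfl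

instance : Module ℂ (Complexification E) where
  one_smul z := by ext <;> simp
  mul_smul c d z := by
    ext <;> simp only [re_smul, im_smul, Complex.mul_re, Complex.mul_im] <;> module
  smul_zero c := by ext <;> simp
  smul_add c z w := by
    ext <;> simp only [re_smul, im_smul, re_add, im_add] <;> module
  add_smul c d z := by
    ext <;> simp only [re_smul, im_smul, re_add, im_add, Complex.add_re, Complex.add_im] <;> module
  zero_smul z := by ext <;> simp

variable [Lattice E] [IsOrderedAddMonoid E] [IsOrderedModule ℝ E] [IsArchimedean E]
  [IsRUComplete E]

/-- The modulus `|x + iy| = sup_{0 ≤ θ < 2π} |cos θ • x + sin θ • y|`, an element of the real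
vector lattice `E`. -/
def modulus (z : Complexification E) : E := Classical.choose (exists_isLUB_rotAbs z.re z.im)

theorem isLUB_modulus (z : Complexification E) :
    IsLUB ((fun θ : ℝ => |Real.cos θ • z.re + Real.sin θ • z.im|) '' Set.Ico 0 (2 * Real.pi))
      (modulus z) :=
  Classical.choose_spec (exists_isLUB_rotAbs z.re z.im)

/-- The positive cone of the complexification is the positive cone of `E`. -/
def IsPos (z : Complexification E) : Prop := 0 ≤ z.re ∧ z.im = 0

end Complexification

open Complexification

section Complex

variable {E : Type u} [AddCommGroup E] [Lattice E] [IsOrderedAddMonoid E] [Module ℝ E]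
  [IsOrderedModule ℝ E] [IsArchimedean E] [IsRUComplete E]

/-- Relative uniform convergence of `f` to `a` along a filter: there is one regulator `v` such
that for every `ε > 0` eventually `|f i - a| ≤ ε v`. A net is the case `l = atTop`. -/
def RUTendsto {ι : Type*} (f : ι → Complexification E) (l : Filter ι) (a : Complexification E) :
    Prop :=
  ∃ v : E, ∀ ε : ℝ, 0 < ε → ∀ᶠ i in l, modulus (f i - a) ≤ ε • v

/-- A set is ru-dense if every element is the ru-limit of a sequence in the set. -/
def RUDense (D : Set (Complexification E)) : Prop :=
  ∀ x, ∃ y : ℕ → Complexification E, (∀ n, y n ∈ D) ∧ RUTendsto y atTop x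

/-- Positive operators map the positive cone into itself. -/
def IsPositiveOperator (T : Complexification E →ₗ[ℂ] Complexification E) : Prop :=
  ∀ x, IsPos x → IsPos (T x)

/-- Property (D) of the complex vector lattice `E + iE`. Nets are indexed by nonempty directed
preorders; those in the universe of `E` realise, up to passing to tails, all nets of operators. -/
def PropertyD (E : Type u) [AddCommGroup E] [Lattice E] [IsOrderedAddMonoid E] [Module ℝ E]
    [IsOrderedModule ℝ E] [IsArchimedean E] [IsRUComplete E] : Prop :=
  ∀ (ι : Type u) [Preorder ι] [IsDirectedOrder ι] [Nonempty ι]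
    (T : ι → Complexification E →ₗ[ℂ] Complexification E),
    (∃ D : Set (Complexification E), RUDense D ∧
      ∀ y ∈ D, RUTendsto (fun i => T i y) atTop 0) →
    (∀ x : ℕ → Complexification E, RUTendsto x atTop 0 →
      ∃ v : E, 0 ≤ v ∧ ∀ ε : ℝ, 0 < ε → ∃ (N : ℕ) (i₀ : ι), ∀ n ≥ N, ∀ i ≥ i₀,
        modulus (T i (x n)) ≤ ε • v) →
    ∀ x, RUTendsto (fun i => T i x) atTop 0

/-- Relatively uniformly continuous functions on `[0, ∞)`: there is a continuity regulator
`v : [0, ∞) → E` such that for each `ε > 0` there is `δ > 0` with `|f(t + h) - f(t)| ≤ ε v(t)`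
for all `t ≥ 0` and `-min {δ, t} ≤ h ≤ δ`. Here `s` plays the role of `t + h`. -/
def RUContinuous (f : ℝ≥0 → Complexification E) : Prop :=
  ∃ v : ℝ≥0 → E, ∀ ε : ℝ, 0 < ε → ∃ δ : ℝ, 0 < δ ∧
    ∀ t s : ℝ≥0, |(s : ℝ) - t| ≤ δ → modulus (f s - f t) ≤ ε • v t

/-- Positive relatively uniformly continuous semigroups. -/
structure IsPositiveRUCSemigroup
    (T : ℝ≥0 → Complexification E →ₗ[ℂ] Complexification E) : Prop where
  map_zero : T 0 = LinearMap.id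
  map_add : ∀ s t, T (s + t) = T t ∘ₗ T s
  ruContinuous_orbit : ∀ x, RUContinuous fun t => T t x
  positive : ∀ t, IsPositiveOperator (T t)

/-- `T` is exponentially order bounded with order exponent `w`. -/
def IsExpOrderBounded (T : ℝ≥0 → Complexification E →ₗ[ℂ] Complexification E) (w : ℝ) : Prop :=
  ∀ x, ∃ v : E, ∀ t : ℝ≥0, modulus (T t x) ≤ Real.exp (w * t) • v

/-- `A` is the generator of `T`: a pair `(x, y)` lies in the graph of `A` exactly when
`(T(h) x - x) / h` converges relatively uniformly to `y` as `h` decreases to `0`. So the domain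
of `A` consists of all `x` for which the limit exists, and `A x` is this limit. -/
def IsGenerator (A : Complexification E →ₗ.[ℂ] Complexification E)
    (T : ℝ≥0 → Complexification E →ₗ[ℂ] Complexification E) : Prop :=
  ∀ x y, (∃ hx : x ∈ A.domain, A ⟨x, hx⟩ = y) ↔
    RUTendsto (fun h : ℝ≥0 => ((h : ℂ)⁻¹) • (T h x - x)) (𝓝[>] 0) y

/-- Relatively uniformly closed operators. -/
def RUClosed (A : Complexification E →ₗ.[ℂ] Complexification E) : Prop :=
  ∀ (x : ℕ → A.domain) (a b : Complexification E),
    RUTendsto (fun n => (x n : Complexification E)) atTop a →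
    RUTendsto (fun n => A (x n)) atTop b →
    ∃ ha : a ∈ A.domain, A ⟨a, ha⟩ = b

end Complex

section Resolvent

variable {V : Type u} [AddCommGroup V] [Module ℂ V]

/-- The linear map `z - A` from the domain of `A` to the whole space. -/
def scalarSub (A : V →ₗ.[ℂ] V) (z : ℂ) : A.domain →ₗ[ℂ] V := z • A.domain.subtype - A.toFun

/-- The set of all `z` for which `(z - A)⁻¹` exists as an operator on the whole space. -/
def opResolventSet (A : V →ₗ.[ℂ] V) : Set ℂ := {z | Function.Bijective (scalarSub A z)}

open Classical in
/-- The resolvent operator `R(z, A) = (z - A)⁻¹`; it takes the value `0` outside of the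
resolvent set. -/
def opResolvent (A : V →ₗ.[ℂ] V) (z : ℂ) : V →ₗ[ℂ] V :=
  if h : Function.Bijective (scalarSub A z) then
    A.domain.subtype ∘ₗ (LinearEquiv.ofBijective (scalarSub A z) h).symm.toLinearMap
  else 0

end Resolvent

/-- The positive resolvent set: the resolvent exists and is a positive operator. -/
def positiveResolventSet {E : Type u} [AddCommGroup E] [Lattice E] [IsOrderedAddMonoid E]
    [Module ℝ E] [IsOrderedModule ℝ E] [IsArchimedean E] [IsRUComplete E]
    (A : Complexification E →ₗ.[ℂ] Complexification E) : Set ℂ :=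
  {z | z ∈ opResolventSet A ∧ IsPositiveOperator (opResolvent A z)}

end RUSemigroup

end

/-!
Everything is done with order estimates; no norm and no integral appears. The two facts behind these
estimates are that `|z| ≤ b` holds as soon as all rotations of `z` have real part at most `b`
(`modulus_le_iff`), and that a positive operator satisfies `|T z| ≤ T |z|`
(`IsPositiveOperator.modulus_le`). Hence a family of positive operators whose orbits are order
bounded maps sets `|z| ≤ c v` into sets `|z| ≤ c w` with one `w` for the whole family
(`OrderEquibounded`). This plays the role of the uniform boundedness principle.

**From the semigroup to the resolvent.** The resolvent at `z` is the Laplace transform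
`R = ∫₀^∞ exp (-z t) T(t) dt`, constructed as the limit of Riemann sums over dyadic grids
(`exists_isLaplaceTransform`). Refining a grid replaces `x` by averages of `exp (-z t) T(t) x` over
one cell, which gives the Cauchy property. Telescoping the Riemann sums gives
`|exp (-z s) T(s) R x - R x + s x| ≤ s b` whenever `|exp (-z t) T(t) x - x| ≤ b` for all `t ≤ s`; so
`R` maps into the domain of the generator and is a right inverse of `z - A`. Since `R` commutes with
the semigroup, it is a left inverse too. If `|T(t) x| ≤ u` for all `t`, then `|T(t) R x| ≤ u / Re z`
for all `t`, and iterating this yields the bound on the powers of `R`. Property (D) is not needed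
in this direction.

**From the resolvent to the semigroup.** Let `J m = (1 - 2⁻ᵐ A)⁻¹` be the backward Euler step of
size `2⁻ᵐ`. By hypothesis all powers of all `J m` form an order equibounded family. On the domain of
`A²` one step of size `2⁻ⁿ` and two steps of half that size differ by `O(4⁻ⁿ)`, so `J n ^ ⌊2ⁿ t⌋ x` is
a Cauchy sequence there (`IsEulerFamily.exists_modulus_step_le`). Property (D) transfers this to all
`x` (`IsEulerFamily.exists_limit`). A second application of property (D), to the family of all
`J m ^ j - 1` with `j 2⁻ᵐ` small, gives continuity at time `0` uniformly in the step size
(`IsEulerFamily.exists_modulus_pow_sub_le`); this yields the semigroup law, the continuity of the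
orbits and `|T(h) x - x - h A x| ≤ h ε v` for small `h`. So the generator of the limit extends `A`, and
it equals `A` because `1 - A` is onto while `1` minus the generator is injective.
-/

namespace RUSemigroup

open Complexification

set_option linter.unusedSectionVars false

/-! ### The modulus -/

section Modulus

variable {E : Type*} [AddCommGroup E] [Lattice E] [IsOrderedAddMonoid E] [Module ℝ E]
  [IsOrderedModule ℝ E] [IsArchimedean E] [IsRUComplete E]

theorem rot_le_modulus (z : Complexification E) (θ : ℝ) :
    Real.cos θ • z.re + Real.sin θ • z.im ≤ modulus z := by
  obtain ⟨φ, hφ, n, hn⟩ : ∃ φ ∈ Set.Ico 0 (2 * Real.pi), ∃ n : ℤ, θ = φ + n * (2 * Real.pi) :=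
    ⟨toIcoMod Real.two_pi_pos 0 θ, by simpa using toIcoMod_mem_Ico Real.two_pi_pos 0 θ,
      toIcoDiv Real.two_pi_pos 0 θ, by simp⟩
  rw [hn, Real.cos_add_int_mul_two_pi, Real.sin_add_int_mul_two_pi]
  exact (le_abs_self _).trans ((isLUB_modulus z).1 ⟨φ, hφ, rfl⟩)

/-- The modulus as the supremum of the real parts of all rotations: absolute values are not
needed, since the rotation by `θ + π` is the negative of the rotation by `θ`. -/
theorem modulus_le_iff {z : Complexification E} {b : E} :
    modulus z ≤ b ↔ ∀ θ : ℝ, Real.cos θ • z.re + Real.sin θ • z.im ≤ b := by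
  refine ⟨fun h θ => (rot_le_modulus z θ).trans h, fun h => (isLUB_modulus z).2 ?_⟩
  rintro _ ⟨θ, -, rfl⟩
  refine abs_le'.2 ⟨h θ, ?_⟩
  have := h (θ + Real.pi)
  rw [Real.cos_add_pi, Real.sin_add_pi] at this
  refine le_trans (le_of_eq ?_) this
  module

theorem re_le_modulus (z : Complexification E) : z.re ≤ modulus z := by
  simpa using rot_le_modulus z 0

theorem neg_re_le_modulus (z : Complexification E) : -z.re ≤ modulus z := by
  simpa using rot_le_modulus z Real.pi

theorem abs_re_le_modulus (z : Complexification E) : |z.re| ≤ modulus z :=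
  abs_le'.2 ⟨re_le_modulus z, neg_re_le_modulus z⟩

theorem abs_im_le_modulus (z : Complexification E) : |z.im| ≤ modulus z := by
  refine abs_le'.2 ⟨by simpa using rot_le_modulus z (Real.pi / 2), ?_⟩
  simpa using rot_le_modulus z (-(Real.pi / 2))

theorem modulus_nonneg (z : Complexification E) : 0 ≤ modulus z :=
  (abs_nonneg _).trans (abs_re_le_modulus z)

theorem modulus_le_abs_add_abs (z : Complexification E) : modulus z ≤ |z.re| + |z.im| := by
  refine modulus_le_iff.2 fun θ => add_le_add ?_ ?_
  · refine (smul_le_abs_smul_abs _ _).trans ?_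
    simpa using smul_le_smul_of_nonneg_right (Real.abs_cos_le_one θ) (abs_nonneg z.re)
  · refine (smul_le_abs_smul_abs _ _).trans ?_
    simpa using smul_le_smul_of_nonneg_right (Real.abs_sin_le_one θ) (abs_nonneg z.im)

theorem modulus_mk_zero {x : E} (hx : 0 ≤ x) : modulus (mk x 0) = x := by
  refine le_antisymm ((modulus_le_abs_add_abs _).trans (by simp [abs_of_nonneg hx])) ?_
  exact re_le_modulus (mk x 0)

@[simp] theorem modulus_zero : modulus (0 : Complexification E) = 0 := modulus_mk_zero le_rfl

theorem eq_zero_of_modulus_le_zero {z : Complexification E} (h : modulus z ≤ 0) : z = 0 := by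
  have key : ∀ a : E, |a| ≤ modulus z → a = 0 := fun a ha =>
    le_antisymm ((le_abs_self a).trans (ha.trans h))
      (neg_nonpos.1 ((neg_le_abs a).trans (ha.trans h)))
  exact Complexification.ext (key _ (abs_re_le_modulus z)) (key _ (abs_im_le_modulus z))

theorem modulus_add_le (z w : Complexification E) : modulus (z + w) ≤ modulus z + modulus w := by
  refine modulus_le_iff.2 fun θ => ?_
  refine le_trans (le_of_eq ?_) (add_le_add (rot_le_modulus z θ) (rot_le_modulus w θ))
  simp only [re_add, im_add]
  module

theorem modulus_smul_le (c : ℂ) (z : Complexification E) : modulus (c • z) ≤ ‖c‖ • modulus z := by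
  refine modulus_le_iff.2 fun θ => ?_
  refine le_trans (le_of_eq ?_)
    (smul_le_smul_of_nonneg_left (rot_le_modulus z (θ - Complex.arg c)) (norm_nonneg c))
  simp only [re_smul, im_smul]
  rw [← Complex.norm_mul_cos_arg c, ← Complex.norm_mul_sin_arg c, Real.cos_sub, Real.sin_sub]
  generalize ‖c‖ = r
  generalize c.arg = φ
  module

theorem modulus_smul (c : ℂ) (z : Complexification E) : modulus (c • z) = ‖c‖ • modulus z := by
  refine le_antisymm (modulus_smul_le c z) ?_
  rcases eq_or_ne c 0 with rfl | hc
  · simp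
  have h := smul_le_smul_of_nonneg_left (modulus_smul_le c⁻¹ (c • z)) (norm_nonneg c)
  rwa [smul_smul, inv_mul_cancel₀ hc, one_smul, norm_inv, smul_smul,
    mul_inv_cancel₀ (norm_ne_zero_iff.2 hc), one_smul] at h

theorem modulus_neg (z : Complexification E) : modulus (-z) = modulus z := by
  simpa using modulus_smul (-1) z

theorem modulus_sub_comm (z w : Complexification E) : modulus (z - w) = modulus (w - z) := by
  rw [← modulus_neg, neg_sub]

theorem modulus_sub_le (z w : Complexification E) : modulus (z - w) ≤ modulus z + modulus w := by
  rw [sub_eq_add_neg, ← modulus_neg w]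
  exact modulus_add_le _ _

theorem modulus_sub_le_add (x y z : Complexification E) :
    modulus (x - z) ≤ modulus (x - y) + modulus (y - z) := by
  simpa using modulus_add_le (x - y) (y - z)

theorem modulus_sum_le {ι : Type*} (s : Finset ι) (f : ι → Complexification E) :
    modulus (∑ i ∈ s, f i) ≤ ∑ i ∈ s, modulus (f i) := by
  classical
  induction s using Finset.induction_on with
  | empty => simp
  | insert a s ha ih =>
    rw [Finset.sum_insert ha, Finset.sum_insert ha]
    exact (modulus_add_le _ _).trans (add_le_add le_rfl ih)

theorem modulus_sum_le_smul {ι : Type*} {s : Finset ι} {f : ι → Complexification E} {c : ι → ℝ}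
    {v : E} (h : ∀ i ∈ s, modulus (f i) ≤ c i • v) :
    modulus (∑ i ∈ s, f i) ≤ (∑ i ∈ s, c i) • v := by
  rw [Finset.sum_smul]
  exact (modulus_sum_le s f).trans (Finset.sum_le_sum h)

/-- An increment estimate: it replaces the mean value inequality for discrete orbits. -/
theorem modulus_sub_le_of_step {f : ℕ → Complexification E} {c : ℕ → ℝ} {v : E} {k : ℕ}
    (h : ∀ j < k, modulus (f (j + 1) - f j) ≤ c j • v) :
    modulus (f k - f 0) ≤ (∑ j ∈ Finset.range k, c j) • v := by
  rw [← Finset.sum_range_sub]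
  exact modulus_sum_le_smul fun i hi => h i (Finset.mem_range.1 hi)

/-- Over a relatively uniformly complete lattice the complexification is relatively uniformly
complete. The Cauchy condition is stated as comparison with a single term of the sequence. -/
theorem exists_ruTendsto_of_cauchy {f : ℕ → Complexification E}
    (h : ∃ v : E, ∀ ε : ℝ, 0 < ε → ∃ N : ℕ, ∀ n ≥ N, modulus (f n - f N) ≤ ε • v) :
    ∃ a, RUTendsto f atTop a := by
  obtain ⟨v, hv⟩ := h
  have hC : ∀ ε : ℝ, 0 < ε → ∃ N : ℕ, ∀ n ≥ N, ∀ m ≥ N, modulus (f n - f m) ≤ ε • v := by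
    intro ε hε
    obtain ⟨N, hN⟩ := hv (ε / 2) (half_pos hε)
    refine ⟨N, fun n hn m hm => (modulus_sub_le_add _ (f N) _).trans ?_⟩
    rw [← add_halves ε, add_smul, modulus_sub_comm (f N)]
    exact add_le_add (hN n hn) (hN m hm)
  obtain ⟨a, u, ha⟩ := IsRUComplete.complete (fun n => (f n).re) ⟨v, fun ε hε => by
    obtain ⟨N, hN⟩ := hC ε hε
    exact ⟨N, fun n hn m hm => (abs_re_le_modulus (f n - f m)).trans (hN n hn m hm)⟩⟩
  obtain ⟨b, w, hb⟩ := IsRUComplete.complete (fun n => (f n).im) ⟨v, fun ε hε => by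
    obtain ⟨N, hN⟩ := hC ε hε
    exact ⟨N, fun n hn m hm => (abs_im_le_modulus (f n - f m)).trans (hN n hn m hm)⟩⟩
  refine ⟨mk a b, u + w, fun ε hε => ?_⟩
  obtain ⟨N₁, h₁⟩ := ha ε hε
  obtain ⟨N₂, h₂⟩ := hb ε hε
  filter_upwards [eventually_ge_atTop N₁, eventually_ge_atTop N₂] with n hn₁ hn₂
  rw [smul_add]
  exact (modulus_le_abs_add_abs _).trans (add_le_add (h₁ n hn₁) (h₂ n hn₂))

end Modulus

/-! ### Relatively uniform convergence -/

section Convergence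

variable {E : Type*} [AddCommGroup E] [Lattice E] [IsOrderedAddMonoid E] [Module ℝ E]
  [IsOrderedModule ℝ E] [IsArchimedean E] [IsRUComplete E]
  {ι κ : Type*} {l : Filter ι} {f g : ι → Complexification E} {a b : Complexification E}

theorem RUTendsto.exists_nonneg (h : RUTendsto f l a) :
    ∃ v : E, 0 ≤ v ∧ ∀ ε : ℝ, 0 < ε → ∀ᶠ i in l, modulus (f i - a) ≤ ε • v := by
  obtain ⟨v, hv⟩ := h
  exact ⟨|v|, abs_nonneg v, fun ε hε => (hv ε hε).mono fun i hi =>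
    hi.trans (smul_le_smul_of_nonneg_left (le_abs_self v) hε.le)⟩

theorem RUTendsto.of_modulus_le {c : ι → ℝ} {v : E} (hc : Tendsto c l (𝓝 0))
    (h : ∀ᶠ i in l, modulus (f i - a) ≤ c i • v) : RUTendsto f l a := by
  refine ⟨|v|, fun ε hε => ?_⟩
  filter_upwards [h, (tendsto_order.1 hc.abs).2 ε (by simpa using hε)] with i hi hci
  refine hi.trans ((smul_le_abs_smul_abs _ _).trans ?_)
  exact smul_le_smul_of_nonneg_right hci.le (abs_nonneg v)

theorem ruTendsto_const (l : Filter ι) (a : Complexification E) : RUTendsto (fun _ => a) l a :=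
  RUTendsto.of_modulus_le (c := fun _ => 0) (v := 0) tendsto_const_nhds (by simp)

theorem RUTendsto.congr' (h : RUTendsto f l a) (hfg : ∀ᶠ i in l, f i = g i) :
    RUTendsto g l a := by
  obtain ⟨v, hv⟩ := h
  refine ⟨v, fun ε hε => ?_⟩
  filter_upwards [hv ε hε, hfg] with i hi hi'
  rwa [← hi']

theorem RUTendsto.comp {l' : Filter κ} {φ : κ → ι} (h : RUTendsto f l a) (hφ : Tendsto φ l' l) :
    RUTendsto (fun k => f (φ k)) l' a := by
  obtain ⟨v, hv⟩ := h
  exact ⟨v, fun ε hε => hφ.eventually (hv ε hε)⟩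

theorem RUTendsto.sub_const (h : RUTendsto f l a) : RUTendsto (fun i => f i - a) l 0 := by
  obtain ⟨v, hv⟩ := h
  exact ⟨v, fun ε hε => by simpa using hv ε hε⟩

theorem RUTendsto.add (hf : RUTendsto f l a) (hg : RUTendsto g l b) :
    RUTendsto (fun i => f i + g i) l (a + b) := by
  obtain ⟨v, hv⟩ := hf
  obtain ⟨w, hw⟩ := hg
  refine ⟨v + w, fun ε hε => ?_⟩
  filter_upwards [hv ε hε, hw ε hε] with i hi hi'
  rw [add_sub_add_comm, smul_add]
  exact (modulus_add_le _ _).trans (add_le_add hi hi')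

theorem RUTendsto.smul {c : ι → ℂ} {c₀ : ℂ} (hc : Tendsto c l (𝓝 c₀)) (hf : RUTendsto f l a) :
    RUTendsto (fun i => c i • f i) l (c₀ • a) := by
  obtain ⟨v, hv0, hv⟩ := hf.exists_nonneg
  refine ⟨(‖c₀‖ + 1) • v + modulus a, fun ε hε => ?_⟩
  have h1 := (tendsto_order.1 (tendsto_iff_norm_sub_tendsto_zero.1 hc)).2 ε hε
  have h2 := (tendsto_order.1 hc.norm).2 (‖c₀‖ + 1) (by linarith)
  filter_upwards [hv ε hε, h1, h2] with i hi hi1 hi2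
  have e : c i • f i - c₀ • a = c i • (f i - a) + (c i - c₀) • a := by module
  rw [e, smul_add, smul_comm ε]
  refine (modulus_add_le _ _).trans (add_le_add ?_ ?_)
  · rw [modulus_smul]
    exact (smul_le_smul_of_nonneg_left hi (norm_nonneg _)).trans
      (smul_le_smul_of_nonneg_right hi2.le (smul_nonneg hε.le hv0))
  · rw [modulus_smul]
    exact smul_le_smul_of_nonneg_right hi1.le (modulus_nonneg a)

theorem RUTendsto.const_smul (c : ℂ) (hf : RUTendsto f l a) :
    RUTendsto (fun i => c • f i) l (c • a) := hf.smul tendsto_const_nhds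

theorem RUTendsto.sub (hf : RUTendsto f l a) (hg : RUTendsto g l b) :
    RUTendsto (fun i => f i - g i) l (a - b) := by
  simpa [sub_eq_add_neg] using hf.add (hg.const_smul (-1))

/-- Order intervals `|z| ≤ b` are closed under relatively uniform limits. The regulator `v` of
the error term is allowed to differ from that of the convergence. -/
theorem RUTendsto.modulus_le_of_eventually [l.NeBot] (h : RUTendsto f l a) {b v : E}
    (hb : ∀ ε : ℝ, 0 < ε → ∀ᶠ i in l, modulus (f i) ≤ b + ε • v) : modulus a ≤ b := by
  obtain ⟨w, hw⟩ := h
  refine le_of_forall_le_add_smul (v := v + w) fun ε hε => ?_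
  obtain ⟨i, hi, hi'⟩ := ((hb ε hε).and (hw ε hε)).exists
  have := modulus_sub_le (f i) (f i - a)
  rw [sub_sub_cancel] at this
  rw [smul_add, ← add_assoc]
  exact this.trans (add_le_add hi hi')

theorem RUTendsto.modulus_le [l.NeBot] (h : RUTendsto f l a) {b : E}
    (hb : ∀ᶠ i in l, modulus (f i) ≤ b) : modulus a ≤ b :=
  h.modulus_le_of_eventually (v := 0) fun ε _ => by simpa using hb

theorem RUTendsto.unique [l.NeBot] (hf : RUTendsto f l a) (hg : RUTendsto f l b) : a = b := by
  have h := hf.sub hg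
  simp only [sub_self] at h
  exact sub_eq_zero.1 (eq_zero_of_modulus_le_zero (h.modulus_le (by simp)))

theorem RUTendsto.isPos [l.NeBot] (h : RUTendsto f l a) (hf : ∀ᶠ i in l, IsPos (f i)) :
    IsPos a := by
  obtain ⟨v, hv⟩ := h
  have him : ∀ c : E, (∀ ε : ℝ, 0 < ε → |c| ≤ ε • v) → c = 0 := by
    intro c hc
    have h0 : |c| ≤ 0 := le_of_forall_le_add_smul (v := v) fun ε hε => by simpa using hc ε hε
    exact le_antisymm ((le_abs_self c).trans h0) (neg_nonpos.1 ((neg_le_abs c).trans h0))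
  refine ⟨le_of_forall_le_add_smul (v := v) fun ε hε => ?_, him _ fun ε hε => ?_⟩
  · obtain ⟨i, hi, hi'⟩ := (hf.and (hv ε hε)).exists
    refine hi.1.trans ?_
    rw [← sub_le_iff_le_add']
    exact (re_le_modulus _).trans hi'
  · obtain ⟨i, hi, hi'⟩ := (hf.and (hv ε hε)).exists
    have := (abs_im_le_modulus _).trans hi'
    rwa [im_sub, hi.2, zero_sub, abs_neg] at this

end Convergence

/-! ### Positive operators and order equibounded families -/

section Operators

variable {E : Type*} [AddCommGroup E] [Lattice E] [IsOrderedAddMonoid E] [Module ℝ E]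
  [IsOrderedModule ℝ E] [IsArchimedean E] [IsRUComplete E]
  {ι κ : Type*}

theorem IsPositiveOperator.comp {S T : Module.End ℂ (Complexification E)}
    (hS : IsPositiveOperator S) (hT : IsPositiveOperator T) : IsPositiveOperator (S * T) :=
  fun x hx => hS _ (hT x hx)

theorem isPositiveOperator_one : IsPositiveOperator (1 : Module.End ℂ (Complexification E)) :=
  fun _ hx => hx

theorem IsPositiveOperator.pow {T : Module.End ℂ (Complexification E)}
    (hT : IsPositiveOperator T) (k : ℕ) : IsPositiveOperator (T ^ k) := by
  induction k with
  | zero => exact isPositiveOperator_one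
  | succ k ih => rw [pow_succ]; exact ih.comp hT

theorem IsPos.smul {z : Complexification E} (hz : IsPos z) {c : ℝ} (hc : 0 ≤ c) :
    IsPos ((c : ℂ) • z) :=
  ⟨by simpa [-Complex.coe_smul] using smul_nonneg hc hz.1, by simp [-Complex.coe_smul, hz.2]⟩

theorem IsPos.add {z w : Complexification E} (hz : IsPos z) (hw : IsPos w) : IsPos (z + w) :=
  ⟨add_nonneg hz.1 hw.1, by simp [hz.2, hw.2]⟩

theorem IsPositiveOperator.smul {T : Module.End ℂ (Complexification E)}
    (hT : IsPositiveOperator T) {c : ℝ} (hc : 0 ≤ c) : IsPositiveOperator ((c : ℂ) • T) :=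
  fun x hx => IsPos.smul (hT x hx) hc

/-- A positive operator maps `E` into `E`. -/
theorem IsPositiveOperator.im_eq_zero {T : Module.End ℂ (Complexification E)}
    (hT : IsPositiveOperator T) (x : E) : (T (mk x 0)).im = 0 := by
  have e : (mk x 0 : Complexification E) = mk (x⁺) 0 - mk (x⁻) 0 := by
    ext
    · simp [posPart_sub_negPart]
    · simp
  rw [e, map_sub, im_sub, (hT (mk x⁺ 0) ⟨posPart_nonneg x, rfl⟩).2,
    (hT (mk x⁻ 0) ⟨negPart_nonneg x, rfl⟩).2,
    sub_zero]

/-- `|T z| ≤ T |z|` for positive operators, in the form `|z| ≤ c v → |T z| ≤ c |T v|`. -/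
theorem IsPositiveOperator.modulus_le {T : Module.End ℂ (Complexification E)}
    (hT : IsPositiveOperator T) {z : Complexification E} {c : ℝ} {v : E} (hc : 0 ≤ c)
    (h : modulus z ≤ c • v) : modulus (T z) ≤ c • modulus (T (mk v 0)) := by
  refine le_trans (modulus_le_iff.2 fun θ => ?_)
    (smul_le_smul_of_nonneg_left (re_le_modulus (T (mk v 0))) hc)
  have e1 : z = mk z.re 0 + Complex.I • mk z.im 0 := by ext <;> simp
  have e2 : mk (c • v - (Real.cos θ • z.re + Real.sin θ • z.im)) 0
      = (c : ℂ) • mk v 0 - (((Real.cos θ : ℝ) : ℂ) • mk z.re 0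
        + ((Real.sin θ : ℝ) : ℂ) • mk z.im 0) := by
    ext <;> simp [-Complex.ofReal_cos, -Complex.ofReal_sin, -Complex.coe_smul]
  have hp := (hT (mk (c • v - (Real.cos θ • z.re + Real.sin θ • z.im)) 0)
    ⟨sub_nonneg.2 ((rot_le_modulus z θ).trans h), rfl⟩).1
  rw [e2, map_sub, map_add, map_smul, map_smul, map_smul] at hp
  simp only [re_sub, re_add, re_smul, Complex.ofReal_re, Complex.ofReal_im, zero_smul,
    sub_zero, sub_nonneg] at hp
  have hT' : (T z).re = (T (mk z.re 0)).re ∧ (T z).im = (T (mk z.im 0)).re := by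
    have := congrArg T e1
    rw [map_add, map_smul] at this
    constructor
    · rw [this]; simp [hT.im_eq_zero]
    · rw [this]; simp [hT.im_eq_zero]
  rw [hT'.1, hT'.2]
  exact hp

/-- A family of operators is order equibounded if for every `v` there is `w ≥ 0` such that every
operator of the family maps `{z | |z| ≤ c v}` into `{z | |z| ≤ c w}` for each `c ≥ 0`. -/
def OrderEquibounded (F : ι → Module.End ℂ (Complexification E)) : Prop :=
  ∀ v : E, ∃ w : E, 0 ≤ w ∧ ∀ (i : ι) (c : ℝ) (z : Complexification E), 0 ≤ c →
    modulus z ≤ c • v → modulus (F i z) ≤ c • w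

/-- For positive operators pointwise order boundedness yields order equiboundedness. -/
theorem OrderEquibounded.of_positive {F : ι → Module.End ℂ (Complexification E)}
    (hF : ∀ i, IsPositiveOperator (F i)) (h : ∀ x, ∃ v : E, ∀ i, modulus (F i x) ≤ v) :
    OrderEquibounded F := by
  intro v
  obtain ⟨w, hw⟩ := h (mk v 0)
  exact ⟨|w|, abs_nonneg w, fun i c z hc hz => ((hF i).modulus_le hc hz).trans
    (smul_le_smul_of_nonneg_left ((hw i).trans (le_abs_self w)) hc)⟩

theorem orderEquibounded_one :
    OrderEquibounded (fun _ : ι => (1 : Module.End ℂ (Complexification E))) :=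
  OrderEquibounded.of_positive (fun _ => isPositiveOperator_one)
    fun x => ⟨modulus x, fun _ => le_rfl⟩

theorem IsPositiveOperator.orderEquibounded {T : Module.End ℂ (Complexification E)}
    (hT : IsPositiveOperator T) : OrderEquibounded (fun _ : ι => T) :=
  OrderEquibounded.of_positive (fun _ => hT) fun x => ⟨modulus (T x), fun _ => le_rfl⟩

theorem OrderEquibounded.comp_index {F : ι → Module.End ℂ (Complexification E)}
    (hF : OrderEquibounded F) (φ : κ → ι) : OrderEquibounded (fun k => F (φ k)) := by
  intro v
  obtain ⟨w, hw, h⟩ := hF v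
  exact ⟨w, hw, fun i => h (φ i)⟩

theorem OrderEquibounded.sub {F G : ι → Module.End ℂ (Complexification E)}
    (hF : OrderEquibounded F) (hG : OrderEquibounded G) :
    OrderEquibounded (fun i => F i - G i) := by
  intro v
  obtain ⟨w, hw, h⟩ := hF v
  obtain ⟨w', hw', h'⟩ := hG v
  refine ⟨w + w', add_nonneg hw hw', fun i c z hc hz => ?_⟩
  rw [smul_add]
  exact (modulus_sub_le _ _).trans (add_le_add (h i c z hc hz) (h' i c z hc hz))

theorem OrderEquibounded.pointwise {F : ι → Module.End ℂ (Complexification E)}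
    (hF : OrderEquibounded F) (x : Complexification E) :
    ∃ w : E, 0 ≤ w ∧ ∀ i, modulus (F i x) ≤ w := by
  obtain ⟨w, hw, h⟩ := hF (modulus x)
  exact ⟨w, hw, fun i => by simpa using h i 1 x zero_le_one (by simp)⟩

theorem OrderEquibounded.ruTendsto_zero {F : ι → Module.End ℂ (Complexification E)}
    (hF : OrderEquibounded F) {l : Filter κ} {φ : κ → ι} {f : κ → Complexification E}
    (hf : RUTendsto f l 0) : RUTendsto (fun k => F (φ k) (f k)) l 0 := by
  obtain ⟨v, hv⟩ := hf
  obtain ⟨w, -, h⟩ := hF v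
  refine ⟨w, fun ε hε => ?_⟩
  filter_upwards [hv ε hε] with i hi
  rw [sub_zero] at hi ⊢
  exact h _ ε _ hε.le hi

/-- Joint convergence: `F_k f_k → b` if `F_k a → b` and `f_k → a`. -/
theorem OrderEquibounded.ruTendsto {F : ι → Module.End ℂ (Complexification E)}
    (hF : OrderEquibounded F) {l : Filter κ} {φ : κ → ι} {f : κ → Complexification E}
    {a b : Complexification E} (hf : RUTendsto f l a) (hb : RUTendsto (fun k => F (φ k) a) l b) :
    RUTendsto (fun k => F (φ k) (f k)) l b := by
  simpa using (hF.ruTendsto_zero (φ := φ) hf.sub_const).add hb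

theorem OrderEquibounded.ruTendsto_apply {T : Module.End ℂ (Complexification E)}
    (hT : OrderEquibounded (fun _ : Unit => T)) {l : Filter κ} {f : κ → Complexification E}
    {a : Complexification E} (hf : RUTendsto f l a) : RUTendsto (fun k => T (f k)) l (T a) :=
  hT.ruTendsto (φ := fun _ => ()) hf (ruTendsto_const _ _)

/-- The pointwise relatively uniform limit of a sequence of operators is an operator. -/
theorem exists_limit_operator {S : ℕ → Module.End ℂ (Complexification E)}
    (h : ∀ x, ∃ a, RUTendsto (fun n => S n x) atTop a) :
    ∃ R : Module.End ℂ (Complexification E), ∀ x, RUTendsto (fun n => S n x) atTop (R x) := by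
  choose R hR using h
  exact ⟨{ toFun := R
           map_add' := fun x y => (hR (x + y)).unique (by simpa using (hR x).add (hR y))
           map_smul' := fun c x => (hR (c • x)).unique (by simpa using (hR x).const_smul c) }, hR⟩

end Operators

/-! ### The Laplace transform of a bounded positive semigroup -/

section Laplace

variable {E : Type*} [AddCommGroup E] [Lattice E] [IsOrderedAddMonoid E] [Module ℝ E]
  [IsOrderedModule ℝ E] [IsArchimedean E] [IsRUComplete E]
  {T : ℝ≥0 → Complexification E →ₗ[ℂ] Complexification E} {z : ℂ}

theorem IsExpOrderBounded.exists_bound (hb : IsExpOrderBounded T 0) (x : Complexification E) :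
    ∃ v : E, ∀ t, modulus (T t x) ≤ v := by
  obtain ⟨v, hv⟩ := hb x
  exact ⟨v, fun t => by simpa using hv t⟩

theorem IsPositiveRUCSemigroup.orderEquibounded (hT : IsPositiveRUCSemigroup T)
    (hb : IsExpOrderBounded T 0) : OrderEquibounded T :=
  OrderEquibounded.of_positive hT.positive hb.exists_bound

theorem IsPositiveRUCSemigroup.ruTendsto_orbit (hT : IsPositiveRUCSemigroup T) (t : ℝ≥0)
    (x : Complexification E) : RUTendsto (fun s => T s x) (𝓝 t) (T t x) := by
  obtain ⟨v, hv⟩ := hT.ruContinuous_orbit x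
  refine ⟨v t, fun ε hε => ?_⟩
  obtain ⟨δ, hδ, h⟩ := hv ε hε
  filter_upwards [Metric.ball_mem_nhds t hδ] with s hs
  exact h t s (le_of_lt hs)

variable (T z) in
/-- The rescaled semigroup `exp (-z t) T(t)`. -/
noncomputable def rescaled (t : ℝ≥0) : Module.End ℂ (Complexification E) :=
  Complex.exp (-(z * t)) • T t

theorem rescaled_apply (t : ℝ≥0) (x : Complexification E) :
    rescaled T z t x = Complex.exp (-(z * t)) • T t x := rfl

theorem rescaled_zero (hT : IsPositiveRUCSemigroup T) (x : Complexification E) :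
    rescaled T z 0 x = x := by
  simp [rescaled_apply, hT.map_zero]

theorem rescaled_add (hT : IsPositiveRUCSemigroup T) (s t : ℝ≥0) (x : Complexification E) :
    rescaled T z (s + t) x = rescaled T z s (rescaled T z t x) := by
  simp only [rescaled_apply, map_smul, smul_smul, ← Complex.exp_add]
  rw [add_comm s t, hT.map_add, LinearMap.comp_apply]
  congr 2
  push_cast
  ring

theorem modulus_rescaled_le {t : ℝ≥0} {x : Complexification E} {u : E}
    (h : modulus (T t x) ≤ u) : modulus (rescaled T z t x) ≤ Real.exp (-(z.re * t)) • u := by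
  rw [rescaled_apply, modulus_smul, Complex.norm_exp]
  simpa using smul_le_smul_of_nonneg_left h (Real.exp_nonneg (-(z.re * t)))

theorem orderEquibounded_rescaled (hT : IsPositiveRUCSemigroup T)
    (hb : IsExpOrderBounded T 0) (hz : 0 < z.re) : OrderEquibounded (rescaled T z) := by
  intro v
  obtain ⟨w, hw, h⟩ := hT.orderEquibounded hb v
  refine ⟨w, hw, fun t c x hc hx => (modulus_rescaled_le (h t c x hc hx)).trans ?_⟩
  have : Real.exp (-(z.re * t)) ≤ 1 := by
    rw [Real.exp_le_one_iff, neg_nonpos]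
    positivity
  simpa using smul_le_smul_of_nonneg_right this (smul_nonneg hc hw)

theorem ruTendsto_rescaled (hT : IsPositiveRUCSemigroup T) (t : ℝ≥0) (x : Complexification E) :
    RUTendsto (fun s => rescaled T z s x) (𝓝 t) (rescaled T z t x) := by
  refine RUTendsto.smul (Continuous.tendsto ?_ t) (hT.ruTendsto_orbit t x)
  exact Complex.continuous_exp.comp
    ((continuous_const.mul (Complex.continuous_ofReal.comp NNReal.continuous_coe)).neg)

/-- The mesh `2⁻ⁿ` of the `n`-th dyadic grid. -/
noncomputable def mesh (n : ℕ) : ℝ≥0 := (2 ^ n)⁻¹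

theorem mesh_pos (n : ℕ) : 0 < mesh n := by unfold mesh; positivity

theorem mesh_le_one (n : ℕ) : mesh n ≤ 1 := inv_le_one_of_one_le₀ (one_le_pow₀ one_le_two)

theorem two_pow_mul_mesh_add (n d : ℕ) : 2 ^ d * mesh (n + d) = mesh n := by
  unfold mesh
  rw [pow_add]
  field_simp

theorem two_pow_mul_mesh (n : ℕ) : 2 ^ n * mesh n = 1 := mul_inv_cancel₀ (by positivity)

theorem tendsto_mesh : Tendsto mesh atTop (𝓝 0) := by
  have : mesh = fun n => (2⁻¹ : ℝ≥0) ^ n := funext fun n => by simp [mesh]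
  rw [this]
  exact tendsto_pow_atTop_nhds_zero_of_lt_one (by simp) (inv_lt_one_of_one_lt₀ one_lt_two)

theorem floor_mul_mesh_le (t : ℝ≥0) (n : ℕ) : ⌊t * 2 ^ n⌋₊ * mesh n ≤ t := by
  calc (⌊t * 2 ^ n⌋₊ : ℝ≥0) * mesh n ≤ t * 2 ^ n * mesh n :=
        mul_le_mul_left (Nat.floor_le (by positivity)) _
    _ = t := by rw [mul_assoc, two_pow_mul_mesh, mul_one]

theorem le_floor_mul_mesh_add (t : ℝ≥0) (n : ℕ) : t ≤ ⌊t * 2 ^ n⌋₊ * mesh n + mesh n := by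
  calc t = t * 2 ^ n * mesh n := by rw [mul_assoc, two_pow_mul_mesh, mul_one]
    _ ≤ (⌊t * 2 ^ n⌋₊ + 1) * mesh n := mul_le_mul_left (Nat.lt_floor_add_one _).le _
    _ = _ := by ring

theorem tendsto_floor_mul_mesh (t : ℝ≥0) :
    Tendsto (fun n => ⌊t * 2 ^ n⌋₊ * mesh n) atTop (𝓝 t) := by
  have h : Tendsto (fun n => t - mesh n) atTop (𝓝 t) := by
    simpa using (tendsto_const_nhds (x := t)).sub tendsto_mesh
  refine tendsto_of_tendsto_of_tendsto_of_le_of_le h tendsto_const_nhds (fun n => ?_)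
    (fun n => floor_mul_mesh_le t n)
  exact tsub_le_iff_right.2 (le_floor_mul_mesh_add t n)

variable (T z) in
/-- The Riemann sum of `∫ exp (-z t) T(t) dt` over `K` cells of the `n`-th dyadic grid. -/
noncomputable def riemannSum (n K : ℕ) : Module.End ℂ (Complexification E) :=
  (mesh n : ℂ) • ∑ k ∈ Finset.range K, rescaled T z (k * mesh n)

theorem riemannSum_apply (n K : ℕ) (x : Complexification E) :
    riemannSum T z n K x = (mesh n : ℂ) • ∑ k ∈ Finset.range K, rescaled T z (k * mesh n) x := by
  simp [riemannSum]

/-- The scalar Riemann sums of `∫₀^∞ exp (-r t) dt = r⁻¹` overshoot by at most the mesh. -/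
theorem mul_sum_exp_le {r h : ℝ} (hr : 0 < r) (hh : 0 < h) (K : ℕ) :
    h * ∑ k ∈ Finset.range K, Real.exp (-(r * (k * h))) ≤ r⁻¹ + h := by
  set q := Real.exp (-(r * h)) with hq
  have hq0 : 0 < q := Real.exp_pos _
  have hq1 : q * (1 + r * h) ≤ 1 := by
    have h1 := Real.add_one_le_exp (r * h)
    calc q * (1 + r * h) ≤ q * Real.exp (r * h) := by gcongr; linarith
      _ = 1 := by rw [hq, ← Real.exp_add]; simp
  have hsum : ∑ k ∈ Finset.range K, Real.exp (-(r * (k * h))) = ∑ k ∈ Finset.range K, q ^ k :=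
    Finset.sum_congr rfl fun k _ => by rw [hq, ← Real.exp_nat_mul]; congr 1; ring
  have hgeom : (∑ k ∈ Finset.range K, q ^ k) * (1 - q) ≤ 1 := by
    have := geom_sum_mul_neg q K
    rw [this]
    linarith [pow_nonneg hq0.le K]
  rw [hsum]
  set S := ∑ k ∈ Finset.range K, q ^ k
  have hS : 0 ≤ S := Finset.sum_nonneg fun k _ => pow_nonneg hq0.le k
  have h1 : S * (r * h) ≤ 1 + r * h := by
    have e : S * (r * h) = S * (q * (1 + r * h) - 1) + (S * (1 - q)) * (1 + r * h) := by ring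
    have e1 : S * (q * (1 + r * h) - 1) ≤ 0 := mul_nonpos_of_nonneg_of_nonpos hS (by linarith)
    have e2 : (S * (1 - q)) * (1 + r * h) ≤ 1 * (1 + r * h) :=
      mul_le_mul_of_nonneg_right hgeom (by positivity)
    linarith
  have e3 : r⁻¹ + h = (1 + r * h) / r := by field_simp
  rw [e3, le_div_iff₀ hr]
  linarith

theorem modulus_riemannSum_le (hz : 0 < z.re) {x : Complexification E} {u : E}
    (h : ∀ t, modulus (T t x) ≤ u) (n K : ℕ) :
    modulus (riemannSum T z n K x) ≤ (z.re⁻¹ + mesh n) • u := by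
  have hu : 0 ≤ u := (modulus_nonneg _).trans (h 0)
  rw [riemannSum_apply, modulus_smul]
  have hn : ‖((mesh n : ℝ≥0) : ℂ)‖ = mesh n := by simp
  have h1 : modulus (∑ k ∈ Finset.range K, rescaled T z (k * mesh n) x)
      ≤ (∑ k ∈ Finset.range K, Real.exp (-(z.re * (k * mesh n)))) • u :=
    modulus_sum_le_smul fun k _ => by simpa using modulus_rescaled_le (z := z) (h (k * mesh n))
  rw [hn]
  refine (smul_le_smul_of_nonneg_left h1 (mesh n).2).trans ?_
  rw [smul_smul]
  exact smul_le_smul_of_nonneg_right (mul_sum_exp_le hz (mesh_pos n) K) hu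

theorem orderEquibounded_riemannSum (hT : IsPositiveRUCSemigroup T)
    (hb : IsExpOrderBounded T 0) (hz : 0 < z.re) :
    OrderEquibounded fun p : ℕ × ℕ => riemannSum T z p.1 p.2 := by
  intro v
  obtain ⟨w, hw, h⟩ := hT.orderEquibounded hb v
  have hr : 0 < z.re⁻¹ := inv_pos.2 hz
  refine ⟨(z.re⁻¹ + 1) • w, smul_nonneg (by positivity) hw, fun p c x hc hx => ?_⟩
  rw [smul_comm]
  refine (modulus_riemannSum_le hz (fun t => h t c x hc hx) p.1 p.2).trans ?_
  refine smul_le_smul_of_nonneg_right ?_ (smul_nonneg hc hw)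
  have := mesh_le_one p.1
  gcongr
  exact_mod_cast this

theorem riemannSum_add (hT : IsPositiveRUCSemigroup T) (n K L : ℕ) (x : Complexification E) :
    riemannSum T z n (K + L) x
      = riemannSum T z n K x + rescaled T z (K * mesh n) (riemannSum T z n L x) := by
  simp only [riemannSum_apply, map_smul, map_sum, ← rescaled_add hT]
  rw [← smul_add, Finset.sum_range_add]
  refine congrArg _ (congrArg _ (Finset.sum_congr rfl fun k _ => ?_))
  rw [Nat.cast_add, add_mul]

/-- Refining the grid amounts to averaging the argument over one cell. -/
theorem riemannSum_refine (hT : IsPositiveRUCSemigroup T) (n d K : ℕ) (x : Complexification E) :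
    riemannSum T z (n + d) (K * 2 ^ d) x = riemannSum T z n K
      (((2 ^ d : ℂ)⁻¹) • ∑ i ∈ Finset.range (2 ^ d), rescaled T z (i * mesh (n + d)) x) := by
  have key : ∀ K : ℕ, ∑ k ∈ Finset.range (K * 2 ^ d), rescaled T z (k * mesh (n + d)) x
      = ∑ k ∈ Finset.range K, rescaled T z (k * mesh n)
        (∑ i ∈ Finset.range (2 ^ d), rescaled T z (i * mesh (n + d)) x) := by
    intro K
    induction K with
    | zero => simp
    | succ K ih =>
      rw [Finset.sum_range_succ, ← ih, Nat.succ_mul, Finset.sum_range_add]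
      congr 1
      rw [map_sum]
      refine Finset.sum_congr rfl fun i _ => ?_
      rw [← rescaled_add hT, ← two_pow_mul_mesh_add n d]
      congr 2
      push_cast
      ring
  rw [riemannSum_apply, key, map_smul, riemannSum_apply, smul_smul]
  congr 1
  rw [← two_pow_mul_mesh_add n d]
  push_cast
  field_simp

theorem modulus_average_sub_le {x : Complexification E} {b : E} {h : ℝ≥0} {M : ℕ} (hM : 0 < M)
    (hx : ∀ i < M, modulus (rescaled T z (i * h) x - x) ≤ b) :
    modulus (((M : ℂ)⁻¹) • ∑ i ∈ Finset.range M, rescaled T z (i * h) x - x) ≤ b := by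
  have hM' : (M : ℂ) ≠ 0 := by exact_mod_cast hM.ne'
  have e : ((M : ℂ)⁻¹) • ∑ i ∈ Finset.range M, rescaled T z (i * h) x - x
      = ((M : ℂ)⁻¹) • ∑ i ∈ Finset.range M, (rescaled T z (i * h) x - x) := by
    rw [Finset.sum_sub_distrib, smul_sub]
    simp [← Nat.cast_smul_eq_nsmul ℂ, smul_smul, hM']
  have h1 := modulus_sum_le_smul (c := fun _ => 1) (v := b)
    (fun i hi => by simpa using hx i (Finset.mem_range.1 hi))
  rw [e, modulus_smul]
  refine (smul_le_smul_of_nonneg_left h1 (norm_nonneg _)).trans (le_of_eq ?_)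
  have hM'' : (M : ℝ) ≠ 0 := by exact_mod_cast hM.ne'
  simp [smul_smul, hM'']

/-- The Riemann sums over `[0, n]` with mesh `2⁻ⁿ` converge. The tail of the integral is controlled by
the factor `exp (-n Re z)`, and refinement by continuity of the orbit at time `0` alone. -/
theorem exists_limit_riemannSum (hT : IsPositiveRUCSemigroup T)
    (hb : IsExpOrderBounded T 0) (hz : 0 < z.re) :
    ∃ R : Module.End ℂ (Complexification E), ∀ x,
      RUTendsto (fun n => riemannSum T z n (n * 2 ^ n) x) atTop (R x) := by
  refine exists_limit_operator fun x => exists_ruTendsto_of_cauchy ?_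
  obtain ⟨v, hv⟩ : ∃ v : E, ∀ ε : ℝ, 0 < ε →
      ∀ᶠ t in 𝓝 (0 : ℝ≥0), modulus (rescaled T z t x - x) ≤ ε • v := by
    simpa only [RUTendsto, rescaled_zero hT] using ruTendsto_rescaled (z := z) hT 0 x
  obtain ⟨w, hw, hvw⟩ := orderEquibounded_riemannSum hT hb hz v
  obtain ⟨u, hu, hxu⟩ := (orderEquibounded_riemannSum hT hb hz).pointwise x
  obtain ⟨u', hu', huu⟩ := hT.orderEquibounded hb u
  refine ⟨w + u', fun ε hε => ?_⟩
  have hlim : Tendsto (fun n : ℕ => Real.exp (-(z.re * n))) atTop (𝓝 0) :=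
    Real.tendsto_exp_neg_atTop_nhds_zero.comp
      (tendsto_natCast_atTop_atTop.const_mul_atTop hz)
  obtain ⟨δ, hδ, hball⟩ := Metric.eventually_nhds_iff.1 (hv ε hε)
  have hmesh : ∀ᶠ n in atTop, (mesh n : ℝ) < δ :=
    (tendsto_order.1 (NNReal.tendsto_coe.2 tendsto_mesh)).2 δ hδ
  obtain ⟨n, hn₁, hn₂⟩ := (hmesh.and ((tendsto_order.1 hlim).2 ε hε)).exists
  refine ⟨n, fun m hm => ?_⟩
  obtain ⟨d, rfl⟩ := Nat.exists_eq_add_of_le hm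
  have e1 : (n + d) * 2 ^ (n + d) = (n * 2 ^ n + d * 2 ^ n) * 2 ^ d := by ring
  have e2 : ((n * 2 ^ n : ℕ) : ℝ≥0) * mesh n = n := by
    push_cast
    rw [mul_assoc, two_pow_mul_mesh, mul_one]
  set y := ((2 ^ d : ℂ)⁻¹) • ∑ i ∈ Finset.range (2 ^ d), rescaled T z (i * mesh (n + d)) x
  have hy : modulus (y - x) ≤ ε • v := by
    have := modulus_average_sub_le (T := T) (z := z) (x := x) (b := ε • v) (h := mesh (n + d))
      (M := 2 ^ d) (by positivity) fun i hi => hball ?_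
    · simpa using this
    · rw [NNReal.dist_eq]
      simp only [NNReal.coe_zero, sub_zero, NNReal.abs_eq]
      refine lt_of_le_of_lt ?_ hn₁
      rw [← two_pow_mul_mesh_add n d]
      have hi' : (i : ℝ≥0) ≤ 2 ^ d := by exact_mod_cast hi.le
      exact_mod_cast mul_le_mul_left hi' (mesh (n + d))
  -- the difference of two Riemann sums: a refinement error and the part of the sum beyond time `n`
  have e3 : riemannSum T z (n + d) ((n + d) * 2 ^ (n + d)) x - riemannSum T z n (n * 2 ^ n) x
      = riemannSum T z n (n * 2 ^ n + d * 2 ^ n) (y - x)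
        + rescaled T z n (riemannSum T z n (d * 2 ^ n) x) := by
    rw [e1, riemannSum_refine hT, map_sub, riemannSum_add hT _ _ _ x, e2]
    abel
  rw [e3, smul_add]
  refine (modulus_add_le _ _).trans (add_le_add (hvw (n, _) ε _ hε.le hy) ?_)
  have h1 : modulus (T n (riemannSum T z n (d * 2 ^ n) x)) ≤ (1 : ℝ) • u' :=
    huu n 1 _ zero_le_one (by simpa using hxu (n, d * 2 ^ n))
  rw [one_smul] at h1
  exact (modulus_rescaled_le h1).trans (smul_le_smul_of_nonneg_right (by simpa using hn₂.le) hu')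

/-- The properties of the Laplace transform `R = ∫₀^∞ exp (-z t) T(t) dt` that identify it with
the resolvent of the generator at `z`. -/
structure IsLaplaceTransform (T : ℝ≥0 → Complexification E →ₗ[ℂ] Complexification E) (z : ℂ)
    (R : Module.End ℂ (Complexification E)) : Prop where
  modulus_le : ∀ x u, (∀ t, modulus (T t x) ≤ u) → modulus (R x) ≤ z.re⁻¹ • u
  comm : ∀ s x, T s (R x) = R (T s x)
  ruTendsto_quotient : ∀ x,
    RUTendsto (fun h : ℝ≥0 => ((h : ℂ)⁻¹) • (T h (R x) - R x)) (𝓝[>] 0) (z • R x - x)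
  positive : z.im = 0 → IsPositiveOperator R

theorem IsPositiveRUCSemigroup.comm (hT : IsPositiveRUCSemigroup T) (s t : ℝ≥0)
    (x : Complexification E) : T s (T t x) = T t (T s x) := by
  rw [← LinearMap.comp_apply, ← LinearMap.comp_apply, ← hT.map_add, ← hT.map_add, add_comm]

theorem riemannSum_comm (hT : IsPositiveRUCSemigroup T) (s : ℝ≥0) (n K : ℕ)
    (x : Complexification E) : T s (riemannSum T z n K x) = riemannSum T z n K (T s x) := by
  simp only [riemannSum_apply, map_smul, map_sum, rescaled_apply]
  congr 1
  exact Finset.sum_congr rfl fun k _ => by rw [hT.comm]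

theorem isPositiveOperator_riemannSum (hT : IsPositiveRUCSemigroup T) (hz : z.im = 0)
    (n K : ℕ) : IsPositiveOperator (riemannSum T z n K) := by
  intro x hx
  rw [riemannSum_apply]
  have hz' : z = (z.re : ℂ) := Complex.ext (by simp) (by simp [hz])
  have h1 : ∀ t, IsPos (rescaled T z t x) := by
    intro t
    have e : Complex.exp (-(z * t)) = ((Real.exp (-(z.re * t)) : ℝ) : ℂ) := by
      rw [hz']; push_cast; simp
    rw [rescaled_apply, e]
    exact IsPos.smul (hT.positive t x hx) (Real.exp_nonneg _)
  refine IsPos.smul (c := (mesh n : ℝ)) ?_ (mesh n).2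
  exact Finset.sum_induction _ IsPos (fun _ _ => IsPos.add) ⟨le_rfl, rfl⟩ fun k _ => h1 _

theorem tendsto_inv_mul_exp_sub_one (z : ℂ) :
    Tendsto (fun h : ℝ≥0 => (h : ℂ)⁻¹ * (Complex.exp (z * h) - 1)) (𝓝[>] 0) (𝓝 z) := by
  have h1 : HasDerivAt (fun w : ℂ => Complex.exp (z * w)) z 0 := by
    simpa using ((hasDerivAt_id (0 : ℂ)).const_mul z).cexp
  have h2 : Tendsto (fun h : ℝ≥0 => (h : ℂ)) (𝓝[>] 0) (𝓝[≠] 0) := by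
    refine tendsto_nhdsWithin_iff.2 ⟨?_, ?_⟩
    · have : Continuous fun h : ℝ≥0 => (h : ℂ) :=
        Complex.continuous_ofReal.comp NNReal.continuous_coe
      simpa using (this.tendsto 0).mono_left nhdsWithin_le_nhds
    · filter_upwards [self_mem_nhdsWithin] with h hh
      simpa using (ne_of_gt hh : h ≠ 0)
  have h3 := (hasDerivAt_iff_tendsto_slope.1 h1).comp h2
  refine h3.congr fun h => ?_
  simp [slope]

/-- Telescoping of Riemann sums, the discrete form of the identity
`exp (-z s) T(s) R - R = -∫₀ˢ exp (-z t) T(t) dt`. -/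
theorem rescaled_riemannSum_sub (hT : IsPositiveRUCSemigroup T) (n k K : ℕ)
    (x : Complexification E) :
    rescaled T z (k * mesh n) (riemannSum T z n K x) - riemannSum T z n K x
      = rescaled T z (K * mesh n) (riemannSum T z n k x) - riemannSum T z n k x := by
  have h1 := riemannSum_add (z := z) hT n k K x
  have h2 := riemannSum_add (z := z) hT n K k x
  rw [add_comm K k] at h2
  rw [sub_eq_sub_iff_add_eq_add, add_comm _ (riemannSum T z n k x), ← h1, h2, add_comm]

theorem modulus_riemannSum_sub_le {x : Complexification E} {b : E} {n k : ℕ} {s : ℝ≥0}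
    (hk : k * mesh n ≤ s) (h : ∀ t ≤ s, modulus (rescaled T z t x - x) ≤ b) :
    modulus (riemannSum T z n k x - ((k * mesh n : ℝ≥0) : ℂ) • x) ≤ ((k * mesh n : ℝ≥0) : ℝ) • b := by
  have e : riemannSum T z n k x - ((k * mesh n : ℝ≥0) : ℂ) • x
      = (mesh n : ℂ) • ∑ i ∈ Finset.range k, (rescaled T z (i * mesh n) x - x) := by
    rw [riemannSum_apply, Finset.sum_sub_distrib, smul_sub]
    simp [← Nat.cast_smul_eq_nsmul ℂ, smul_smul, mul_comm]
  have h1 := modulus_sum_le_smul (s := Finset.range k) (c := fun _ => 1) (v := b)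
    (f := fun i => rescaled T z (i * mesh n) x - x)
    (fun i hi => by
      have hi' : (i : ℝ≥0) ≤ k := by exact_mod_cast (Finset.mem_range.1 hi).le
      simpa using h (i * mesh n) ((mul_le_mul_left hi' _).trans hk))
  rw [e, modulus_smul]
  refine (smul_le_smul_of_nonneg_left h1 (norm_nonneg _)).trans (le_of_eq ?_)
  simp [smul_smul, mul_comm]

theorem exists_isLaplaceTransform (hT : IsPositiveRUCSemigroup T)
    (hb : IsExpOrderBounded T 0) (hz : 0 < z.re) :
    ∃ R : Module.End ℂ (Complexification E), IsLaplaceTransform T z R := by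
  obtain ⟨R, hR⟩ := exists_limit_riemannSum hT hb hz
  have hlim : Tendsto (fun n : ℕ => Real.exp (-(z.re * n))) atTop (𝓝 0) :=
    Real.tendsto_exp_neg_atTop_nhds_zero.comp
      (tendsto_natCast_atTop_atTop.const_mul_atTop hz)
  refine ⟨R, ?_, ?_, ?_, ?_⟩
  · intro x u hu
    have hu0 : 0 ≤ u := (modulus_nonneg _).trans (hu 0)
    refine (hR x).modulus_le_of_eventually (v := u) fun ε hε => ?_
    filter_upwards [(tendsto_order.1 (NNReal.tendsto_coe.2 tendsto_mesh)).2 ε hε] with n hn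
    rw [← add_smul]
    refine (modulus_riemannSum_le hz hu n _).trans (smul_le_smul_of_nonneg_right ?_ hu0)
    linarith
  · intro s x
    have h1 := ((hT.positive s).orderEquibounded (ι := Unit)).ruTendsto_apply (hR x)
    simp only [riemannSum_comm hT] at h1
    exact h1.unique (hR (T s x))
  · intro x
    obtain ⟨v, hv⟩ : ∃ v : E, ∀ ε : ℝ, 0 < ε →
        ∀ᶠ t in 𝓝 (0 : ℝ≥0), modulus (rescaled T z t x - x) ≤ ε • v := by
      simpa only [RUTendsto, rescaled_zero hT] using ruTendsto_rescaled (z := z) hT 0 x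
    obtain ⟨u, hu, hxu⟩ := (orderEquibounded_riemannSum hT hb hz).pointwise x
    obtain ⟨u', hu', huu⟩ := hT.orderEquibounded hb u
    -- the integrated estimate `|exp (-z s) T(s) R x - R x + s x| ≤ s b`
    have key : ∀ (s : ℝ≥0) (b : E), (∀ t ≤ s, modulus (rescaled T z t x - x) ≤ b) →
        modulus (rescaled T z s (R x) - R x + (s : ℂ) • x) ≤ (s : ℝ) • b := by
      intro s b hsb
      have hb0 : 0 ≤ b := (modulus_nonneg _).trans (hsb 0 (zero_le))
      have hs := tendsto_floor_mul_mesh s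
      have hs' : Tendsto (fun n : ℕ => ((⌊s * 2 ^ n⌋₊ * mesh n : ℝ≥0) : ℂ)) atTop (𝓝 (s : ℂ)) :=
        ((Complex.continuous_ofReal.comp NNReal.continuous_coe).tendsto s).comp hs
      have h1 := (orderEquibounded_rescaled hT hb hz).ruTendsto (hR x)
        ((ruTendsto_rescaled (z := z) hT s (R x)).comp hs)
      have h2 := (h1.sub (hR x)).add ((ruTendsto_const atTop x).smul hs')
      refine h2.modulus_le_of_eventually (v := u') fun ε hε => ?_
      filter_upwards [(tendsto_order.1 hlim).2 ε hε] with n hn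
      have e2 : ((n * 2 ^ n : ℕ) : ℝ≥0) * mesh n = n := by
        push_cast
        rw [mul_assoc, two_pow_mul_mesh, mul_one]
      have h3 : modulus (T n (riemannSum T z n ⌊s * 2 ^ n⌋₊ x)) ≤ (1 : ℝ) • u' :=
        huu n 1 _ zero_le_one (by simpa using hxu (n, ⌊s * 2 ^ n⌋₊))
      rw [one_smul] at h3
      have h4 := modulus_riemannSum_sub_le (z := z) (T := T) (floor_mul_mesh_le s n) hsb
      rw [rescaled_riemannSum_sub hT, e2, sub_add]
      refine (modulus_sub_le _ _).trans ?_
      rw [add_comm]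
      refine add_le_add (h4.trans ?_) ((modulus_rescaled_le h3).trans ?_)
      · exact smul_le_smul_of_nonneg_right (NNReal.coe_le_coe.2 (floor_mul_mesh_le s n)) hb0
      · exact smul_le_smul_of_nonneg_right (by simpa using hn.le) hu'
    have hP : RUTendsto (fun h : ℝ≥0 => ((h : ℂ)⁻¹) • (rescaled T z h (R x) - R x)) (𝓝[>] 0)
        (-x) := by
      refine ⟨v, fun ε hε => ?_⟩
      obtain ⟨δ, hδ, hball⟩ := Metric.eventually_nhds_iff.1 (hv ε hε)
      filter_upwards [self_mem_nhdsWithin, nhdsWithin_le_nhds (Metric.ball_mem_nhds 0 hδ)]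
        with h hh hhδ
      have hh0 : (h : ℂ) ≠ 0 := by simpa using (ne_of_gt hh : h ≠ 0)
      have hh1 : (h : ℝ) ≠ 0 := by simpa using (ne_of_gt hh : h ≠ 0)
      have h5 := key h (ε • v) fun t ht => hball (by
        rw [Metric.mem_ball, NNReal.dist_eq] at hhδ
        rw [NNReal.dist_eq]
        simp only [NNReal.coe_zero, sub_zero, NNReal.abs_eq] at hhδ ⊢
        exact lt_of_le_of_lt ht hhδ)
      have e : ((h : ℂ)⁻¹) • (rescaled T z h (R x) - R x) - -x
          = ((h : ℂ)⁻¹) • (rescaled T z h (R x) - R x + (h : ℂ) • x) := by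
        rw [smul_add, smul_smul, inv_mul_cancel₀ hh0, one_smul, sub_neg_eq_add]
      rw [e, modulus_smul]
      refine (smul_le_smul_of_nonneg_left h5 (norm_nonneg _)).trans (le_of_eq ?_)
      simp [smul_smul, hh1]
    have hexp : Tendsto (fun h : ℝ≥0 => Complex.exp (z * h)) (𝓝[>] 0) (𝓝 1) := by
      have : Continuous fun h : ℝ≥0 => Complex.exp (z * h) := Complex.continuous_exp.comp
        (continuous_const.mul (Complex.continuous_ofReal.comp NNReal.continuous_coe))
      simpa using (this.tendsto 0).mono_left nhdsWithin_le_nhds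
    have h6 := (hP.smul hexp).add
      ((ruTendsto_const (𝓝[>] (0 : ℝ≥0)) (R x)).smul (tendsto_inv_mul_exp_sub_one z))
    rw [one_smul, neg_add_eq_sub] at h6
    refine h6.congr' (Eventually.of_forall fun h => ?_)
    have e : Complex.exp (z * h) * Complex.exp (-(z * h)) = 1 := by
      rw [← Complex.exp_add, add_neg_cancel, Complex.exp_zero]
    have e' : T h (R x) = Complex.exp (z * h) • rescaled T z h (R x) := by
      rw [rescaled_apply, smul_smul, e, one_smul]
    rw [e']
    module
  · intro hz' x hx
    exact (hR x).isPos (Eventually.of_forall fun n => isPositiveOperator_riemannSum hT hz' n _ x hx)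

namespace IsLaplaceTransform

variable {R : Module.End ℂ (Complexification E)}

theorem orderEquibounded (hR : IsLaplaceTransform T z R) (hT : IsPositiveRUCSemigroup T)
    (hb : IsExpOrderBounded T 0) (hz : 0 < z.re) : OrderEquibounded fun _ : Unit => R := by
  intro v
  obtain ⟨w, hw, h⟩ := hT.orderEquibounded hb v
  refine ⟨z.re⁻¹ • w, smul_nonneg (inv_pos.2 hz).le hw, fun _ c x hc hx => ?_⟩
  rw [smul_comm]
  exact hR.modulus_le x _ fun t => h t c x hc hx

/-- The Laplace transform is a left inverse of `z - A`. -/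
theorem apply_sub (hR : IsLaplaceTransform T z R) (hT : IsPositiveRUCSemigroup T)
    (hb : IsExpOrderBounded T 0) (hz : 0 < z.re) {x y : Complexification E}
    (h : RUTendsto (fun h : ℝ≥0 => ((h : ℂ)⁻¹) • (T h x - x)) (𝓝[>] 0) y) :
    R (z • x - y) = x := by
  have h1 := (hR.orderEquibounded hT hb hz).ruTendsto_apply h
  simp only [map_smul, map_sub, ← hR.comm] at h1
  rw [map_sub, map_smul, h1.unique (hR.ruTendsto_quotient x), sub_sub_cancel]

/-- The orbit of `R x` is bounded by `(Re z)⁻¹ u` if that of `x` is bounded by `u`, so the bound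
for powers follows by iteration. -/
theorem modulus_pow_le (hR : IsLaplaceTransform T z R) (hT : IsPositiveRUCSemigroup T)
    {x : Complexification E} {u : E}
    (hu : ∀ t, modulus (T t x) ≤ u) (k : ℕ) (t : ℝ≥0) :
    modulus (T t ((R ^ k) x)) ≤ ((z.re ^ k)⁻¹ : ℝ) • u := by
  induction k generalizing x u with
  | zero => simpa using hu t
  | succ k ih =>
    have h1 : ∀ t, modulus (T t (R x)) ≤ z.re⁻¹ • u := by
      intro t
      rw [hR.comm]
      refine hR.modulus_le _ u fun s => ?_
      rw [← LinearMap.comp_apply, ← hT.map_add]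
      exact hu _
    rw [pow_succ, Module.End.mul_apply]
    refine (ih h1).trans (le_of_eq ?_)
    rw [smul_smul, pow_succ, mul_inv]

end IsLaplaceTransform

end Laplace

/-! ### Generators of bounded positive semigroups -/

section Generator

theorem opResolvent_scalarSub {V : Type*} [AddCommGroup V] [Module ℂ V] {A : V →ₗ.[ℂ] V} {z : ℂ}
    (hz : z ∈ opResolventSet A) (x : A.domain) : opResolvent A z (scalarSub A z x) = x := by
  have hz' : Function.Bijective (scalarSub A z) := hz
  simp only [opResolvent, dif_pos hz', LinearMap.comp_apply, LinearEquiv.coe_coe]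
  have := (LinearEquiv.ofBijective (scalarSub A z) hz').symm_apply_apply x
  rw [LinearEquiv.ofBijective_apply] at this
  rw [this]
  rfl

theorem opResolvent_sub {V : Type*} [AddCommGroup V] [Module ℂ V] {A : V →ₗ.[ℂ] V} {z : ℂ}
    (hz : z ∈ opResolventSet A) {x y : V} (h : (x, y) ∈ A.graph) :
    opResolvent A z (z • x - y) = x := by
  obtain ⟨x, rfl, rfl⟩ := A.mem_graph_iff.1 h
  exact opResolvent_scalarSub hz x

theorem opResolvent_mem_graph {V : Type*} [AddCommGroup V] [Module ℂ V] {A : V →ₗ.[ℂ] V} {z : ℂ}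
    (hz : z ∈ opResolventSet A) (x : V) :
    (opResolvent A z x, z • opResolvent A z x - x) ∈ A.graph := by
  obtain ⟨y, rfl⟩ := Function.Bijective.surjective hz x
  rw [opResolvent_scalarSub hz]
  refine A.mem_graph_iff.2 ⟨y, rfl, ?_⟩
  simp [scalarSub]

/-- A two-sided inverse of `z - A`, given in terms of the graph of `A`, is the resolvent. -/
theorem opResolvent_eq_of_inverse {V : Type*} [AddCommGroup V] [Module ℂ V] {A : V →ₗ.[ℂ] V}
    {z : ℂ} {R : Module.End ℂ V} (h₁ : ∀ x, (R x, z • R x - x) ∈ A.graph)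
    (h₂ : ∀ x y, (x, y) ∈ A.graph → R (z • x - y) = x) :
    z ∈ opResolventSet A ∧ opResolvent A z = R := by
  have hz : z ∈ opResolventSet A := by
    refine ⟨fun a b hab => ?_, fun x => ?_⟩
    · have ha := h₂ _ _ (A.mem_graph a)
      have hb := h₂ _ _ (A.mem_graph b)
      refine Subtype.ext (ha.symm.trans (Eq.trans ?_ hb))
      exact congrArg R hab
    · obtain ⟨y, hy, hy'⟩ := A.mem_graph_iff.1 (h₁ x)
      refine ⟨y, ?_⟩
      change z • (y : V) - A y = x
      rw [hy, hy', sub_sub_cancel]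
  refine ⟨hz, LinearMap.ext fun x => ?_⟩
  have := opResolvent_sub hz (h₁ x)
  rwa [sub_sub_cancel] at this

variable {E : Type*} [AddCommGroup E] [Lattice E] [IsOrderedAddMonoid E] [Module ℝ E]
  [IsOrderedModule ℝ E] [IsArchimedean E] [IsRUComplete E]
  {A : Complexification E →ₗ.[ℂ] Complexification E}
  {T : ℝ≥0 → Complexification E →ₗ[ℂ] Complexification E}

theorem IsGenerator.mem_graph_iff (hA : IsGenerator A T) {x y : Complexification E} :
    (x, y) ∈ A.graph ↔
      RUTendsto (fun h : ℝ≥0 => ((h : ℂ)⁻¹) • (T h x - x)) (𝓝[>] 0) y := by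
  rw [← hA x y, LinearPMap.mem_graph_iff]
  constructor
  · rintro ⟨⟨a, ha⟩, rfl, h⟩
    exact ⟨ha, h⟩
  · rintro ⟨ha, h⟩
    exact ⟨⟨x, ha⟩, rfl, h⟩

theorem IsGenerator.exists_resolvent (hA : IsGenerator A T) (hT : IsPositiveRUCSemigroup T)
    (hb : IsExpOrderBounded T 0) {z : ℂ} (hz : 0 < z.re) :
    z ∈ opResolventSet A ∧ IsLaplaceTransform T z (opResolvent A z) := by
  obtain ⟨R, hR⟩ := exists_isLaplaceTransform hT hb hz
  obtain ⟨h1, h2⟩ := opResolvent_eq_of_inverse (A := A) (z := z) (R := R)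
    (fun x => hA.mem_graph_iff.2 (hR.ruTendsto_quotient x))
    (fun x y h => hR.apply_sub hT hb hz (hA.mem_graph_iff.1 h))
  exact ⟨h1, h2 ▸ hR⟩

/-- The elements `R (x - h⁻¹ (T(h) x - x))`, with `R` the resolvent at `1`, lie in the domain of
the generator and converge to `x` as `h` decreases to `0`. -/
theorem IsGenerator.ruDense_domain (hA : IsGenerator A T) (hT : IsPositiveRUCSemigroup T)
    (hb : IsExpOrderBounded T 0) : RUDense (A.domain : Set (Complexification E)) := by
  intro x
  obtain ⟨h1, hR⟩ := hA.exists_resolvent hT hb (z := 1) (by simp)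
  have hseq : Tendsto mesh atTop (𝓝[>] 0) :=
    tendsto_nhdsWithin_iff.2 ⟨tendsto_mesh, Eventually.of_forall mesh_pos⟩
  refine ⟨fun n => opResolvent A 1 (x - ((mesh n : ℂ)⁻¹) • (T (mesh n) x - x)), fun n =>
    LinearPMap.mem_domain_of_mem_graph (opResolvent_mem_graph h1 _), ?_⟩
  have h2 := (ruTendsto_const atTop (opResolvent A 1 x)).sub
    ((hR.ruTendsto_quotient x).comp hseq)
  rw [one_smul, sub_sub_cancel] at h2
  refine h2.congr' (Eventually.of_forall fun n => ?_)
  simp only [map_sub, map_smul, hR.comm]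

theorem IsGenerator.ruClosed (hA : IsGenerator A T) (hT : IsPositiveRUCSemigroup T)
    (hb : IsExpOrderBounded T 0) : RUClosed A := by
  intro x a b ha hb'
  obtain ⟨h1, hR⟩ := hA.exists_resolvent hT hb (z := 1) (by simp)
  have h2 := (hR.orderEquibounded hT hb (by simp)).ruTendsto_apply (ha.sub hb')
  have h3 : opResolvent A 1 (a - b) = a := by
    refine h2.unique (ha.congr' (Eventually.of_forall fun n => ?_))
    simpa using (opResolvent_sub h1 (A.mem_graph (x n))).symm
  have h4 := opResolvent_mem_graph h1 (a - b)
  rw [h3, one_smul, sub_sub_cancel] at h4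
  exact (hA a b).2 (hA.mem_graph_iff.1 h4)

end Generator

/-! ### Property (D) with uniformity in a parameter -/

section Uniform

/-- Pairs `(n, y)` preordered by `n` alone. Convergence along this directed preorder is convergence
as `n → ∞` that is uniform in the parameter `y`. -/
def UniformIndex.{w} (Y : Type) : Type w := ULift.{w} (ℕ × Y)

instance (Y : Type) : Preorder (UniformIndex Y) := Preorder.lift fun i => i.down.1

instance (Y : Type) : IsDirectedOrder (UniformIndex Y) :=
  ⟨fun i j => (le_total i.down.1 j.down.1).elim (fun h => ⟨j, h, le_refl j.down.1⟩)
    fun h => ⟨i, le_refl i.down.1, h⟩⟩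

instance (Y : Type) [Nonempty Y] : Nonempty (UniformIndex Y) :=
  ⟨⟨(0, Classical.arbitrary Y)⟩⟩

variable {E : Type*} [AddCommGroup E] [Lattice E] [IsOrderedAddMonoid E] [Module ℝ E]
  [IsOrderedModule ℝ E] [IsArchimedean E] [IsRUComplete E]

/-- For an order equibounded family property (D) extends relatively uniform convergence to `0`,
uniform in a parameter, from an ru-dense set to the whole space. -/
theorem PropertyD.forall_of_ruDense (hD : PropertyD E) {Y : Type} [Nonempty Y]
    {F : ℕ × Y → Module.End ℂ (Complexification E)} (hF : OrderEquibounded F)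
    {D : Set (Complexification E)} (hdense : RUDense D)
    (h : ∀ x ∈ D, ∃ v : E, ∀ ε : ℝ, 0 < ε → ∃ N : ℕ, ∀ n ≥ N, ∀ y, modulus (F (n, y) x) ≤ ε • v)
    (x : Complexification E) :
    ∃ v : E, ∀ ε : ℝ, 0 < ε → ∃ N : ℕ, ∀ n ≥ N, ∀ y, modulus (F (n, y) x) ≤ ε • v := by
  have key := hD (UniformIndex Y) (fun i => F i.down) ⟨D, hdense, fun x hx => ?_⟩ ?_ x
  · obtain ⟨v, hv⟩ := key
    refine ⟨v, fun ε hε => ?_⟩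
    obtain ⟨i, hi⟩ := eventually_atTop.1 (hv ε hε)
    exact ⟨i.down.1, fun n hn y => by simpa using hi ⟨(n, y)⟩ hn⟩
  · obtain ⟨v, hv⟩ := h x hx
    refine ⟨v, fun ε hε => ?_⟩
    obtain ⟨N, hN⟩ := hv ε hε
    exact eventually_atTop.2 ⟨⟨(N, Classical.arbitrary Y)⟩, fun i hi => by
      simpa using hN i.down.1 hi i.down.2⟩
  · intro f hf
    obtain ⟨v, hv⟩ := hf
    obtain ⟨w, hw, hvw⟩ := hF v
    refine ⟨w, hw, fun ε hε => ?_⟩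
    obtain ⟨N, hN⟩ := eventually_atTop.1 (hv ε hε)
    exact ⟨N, Classical.arbitrary _, fun n hn i _ => hvw _ ε _ hε.le (by simpa using hN n hn)⟩

end Uniform

/-! ### Backward Euler approximation -/

section Euler

variable {E : Type*} [AddCommGroup E] [Lattice E] [IsOrderedAddMonoid E] [Module ℝ E]
  [IsOrderedModule ℝ E] [IsArchimedean E] [IsRUComplete E]
  {A : Complexification E →ₗ.[ℂ] Complexification E}
  {J : ℕ → Module.End ℂ (Complexification E)}

/-- The properties of the backward Euler steps `J m = (1 - s A)⁻¹` with `s = mesh m`: positivity,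
stability, and the relations to the graph of `A`. -/
structure IsEulerFamily (A : Complexification E →ₗ.[ℂ] Complexification E)
    (J : ℕ → Module.End ℂ (Complexification E)) : Prop where
  positive : ∀ m, IsPositiveOperator (J m)
  bounded : ∀ x, ∃ v : E, ∀ m j, modulus ((J m ^ j) x) ≤ v
  apply_eq : ∀ m x y, (x, y) ∈ A.graph → J m x = x + (mesh m : ℂ) • J m y
  map_graph : ∀ m x y, (x, y) ∈ A.graph → (J m x, J m y) ∈ A.graph
  mem_graph : ∀ m x, (J m x, (mesh m : ℂ)⁻¹ • (J m x - x)) ∈ A.graph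

namespace IsEulerFamily

theorem orderEquibounded (hJ : IsEulerFamily A J) :
    OrderEquibounded fun p : ℕ × ℕ => J p.1 ^ p.2 :=
  OrderEquibounded.of_positive (fun p => (hJ.positive p.1).pow p.2) fun x => by
    obtain ⟨v, hv⟩ := hJ.bounded x
    exact ⟨v, fun p => hv p.1 p.2⟩

theorem pow_succ_sub_pow (hJ : IsEulerFamily A J) {x y : Complexification E}
    (h : (x, y) ∈ A.graph) (m j : ℕ) :
    (J m ^ (j + 1)) x - (J m ^ j) x = (mesh m : ℂ) • (J m ^ (j + 1)) y := by
  simp only [pow_succ, Module.End.mul_apply]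
  rw [hJ.apply_eq m x y h, map_add, map_smul, add_sub_cancel_left]

theorem pow_map_graph (hJ : IsEulerFamily A J) {x y : Complexification E}
    (h : (x, y) ∈ A.graph) (m j : ℕ) : ((J m ^ j) x, (J m ^ j) y) ∈ A.graph := by
  induction j with
  | zero => exact h
  | succ j ih =>
    simp only [pow_succ', Module.End.mul_apply]
    exact hJ.map_graph m _ _ ih

/-- Continuity of the discrete orbits at time `0`, uniformly in the step size. -/
theorem exists_modulus_pow_sub_le (hJ : IsEulerFamily A J) (hD : PropertyD E)
    (hA : RUDense (A.domain : Set (Complexification E))) (x : Complexification E) :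
    ∃ v : E, ∀ ε : ℝ, 0 < ε → ∃ δ : ℝ≥0, 0 < δ ∧ ∀ m j : ℕ, j * mesh m ≤ δ →
      modulus ((J m ^ j) x - x) ≤ ε • v := by
  classical
  -- Only powers `J m ^ j` with `j 2⁻ᵐ ≤ 2⁻ⁿ` enter the `n`-th member of the family.
  let F : ℕ × (ℕ × ℕ) → Module.End ℂ (Complexification E) := fun p =>
    if p.2.2 * mesh p.2.1 ≤ mesh p.1 then J p.2.1 ^ p.2.2 - 1 else 0
  have hF : OrderEquibounded F := by
    intro v
    obtain ⟨w, hw, h⟩ := (hJ.orderEquibounded.sub orderEquibounded_one) v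
    refine ⟨w, hw, fun p c z hc hz => ?_⟩
    by_cases hp : p.2.2 * mesh p.2.1 ≤ mesh p.1
    · simp only [F, if_pos hp]
      exact h p.2 c z hc hz
    · simpa only [F, if_neg hp, LinearMap.zero_apply, modulus_zero] using smul_nonneg hc hw
  have hsmall : ∀ x ∈ (A.domain : Set (Complexification E)), ∃ v : E, ∀ ε : ℝ, 0 < ε →
      ∃ N : ℕ, ∀ n ≥ N, ∀ p, modulus (F (n, p) x) ≤ ε • v := by
    intro x hx
    obtain ⟨u, hu, hAu⟩ := hJ.orderEquibounded.pointwise (A ⟨x, hx⟩)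
    refine ⟨u, fun ε hε => ?_⟩
    obtain ⟨N, hN⟩ := eventually_atTop.1
      ((tendsto_order.1 (NNReal.tendsto_coe.2 tendsto_mesh)).2 ε hε)
    refine ⟨N, fun n hn p => ?_⟩
    by_cases hp : p.2 * mesh p.1 ≤ mesh n
    · simp only [F, if_pos hp]
      have h1 := modulus_sub_le_of_step (f := fun j => (J p.1 ^ j) x)
        (c := fun _ => (mesh p.1 : ℝ)) (v := u) (k := p.2) fun j _ => by
          rw [hJ.pow_succ_sub_pow (A.mem_graph ⟨x, hx⟩), modulus_smul]
          simpa using smul_le_smul_of_nonneg_left (hAu (p.1, j + 1)) (mesh p.1).2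
      refine le_trans (by simpa using h1) (smul_le_smul_of_nonneg_right ?_ hu)
      exact le_trans (by exact_mod_cast hp) (hN n hn).le
    · simpa only [F, if_neg hp, LinearMap.zero_apply, modulus_zero] using smul_nonneg hε.le hu
  obtain ⟨v, hv⟩ := hD.forall_of_ruDense hF hA hsmall x
  refine ⟨v, fun ε hε => ?_⟩
  obtain ⟨N, hN⟩ := hv ε hε
  refine ⟨mesh N, mesh_pos N, fun m j hmj => ?_⟩
  simpa [F, hmj] using hN N le_rfl (m, j)

/-- The domain of `A²` is ru-dense: `J m (J m x)` converges to `x`. -/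
theorem ruDense_domain_sq (hJ : IsEulerFamily A J) (hD : PropertyD E)
    (hA : RUDense (A.domain : Set (Complexification E))) :
    RUDense {x | ∃ y z, (x, y) ∈ A.graph ∧ (y, z) ∈ A.graph} := by
  intro x
  obtain ⟨v, hv⟩ := hJ.exists_modulus_pow_sub_le hD hA x
  refine ⟨fun m => (J m ^ 2) x, fun m => ?_, v, fun ε hε => ?_⟩
  · have e : (J m ^ 2) x = J m (J m x) := by rw [pow_two, Module.End.mul_apply]
    refine ⟨_, _, e ▸ hJ.mem_graph m (J m x), A.graph.smul_mem (mesh m : ℂ)⁻¹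
      (A.graph.sub_mem (hJ.mem_graph m (J m x)) (hJ.mem_graph m x))⟩
  · obtain ⟨δ, hδ, h⟩ := hv ε hε
    have h2 : Tendsto (fun m => ((2 : ℕ) : ℝ≥0) * mesh m) atTop (𝓝 0) := by
      simpa using tendsto_mesh.const_mul ((2 : ℕ) : ℝ≥0)
    filter_upwards [(tendsto_order.1 h2).2 δ hδ] with m hm
    exact h m 2 hm.le

theorem mesh_eq_two_mul (n : ℕ) : (mesh n : ℂ) = 2 * mesh (n + 1) := by
  have := two_pow_mul_mesh_add n 1
  rw [← this]
  push_cast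
  ring

/-- Taylor expansion to second order. -/
theorem apply_eq_taylor (hJ : IsEulerFamily A J) {x y z : Complexification E}
    (hxy : (x, y) ∈ A.graph) (hyz : (y, z) ∈ A.graph) (m : ℕ) :
    J m x = x + (mesh m : ℂ) • y + (mesh m : ℂ) ^ 2 • J m z := by
  rw [hJ.apply_eq m x y hxy, hJ.apply_eq m y z hyz]
  module

/-- The consistency error between one step and two steps of half the size is of second order. -/
theorem modulus_sq_sub_le (hJ : IsEulerFamily A J) {x y z : Complexification E} {u : E}
    (hxy : (x, y) ∈ A.graph) (hyz : (y, z) ∈ A.graph) {n : ℕ}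
    (h₁ : modulus (J n z) ≤ u) (h₂ : modulus (J (n + 1) z) ≤ u)
    (h₃ : modulus (J (n + 1) (J (n + 1) z)) ≤ u) :
    modulus (J (n + 1) (J (n + 1) x) - J n x) ≤ (7 * (mesh (n + 1) : ℝ) ^ 2) • u := by
  set s : ℂ := (mesh (n + 1) : ℂ) with hs
  have e : J (n + 1) (J (n + 1) x) - J n x
      = s ^ 2 • ((2 : ℂ) • J (n + 1) z + J (n + 1) (J (n + 1) z) - (4 : ℂ) • J n z) := by
    have h4 : J (n + 1) y = y + s • J (n + 1) z := hJ.apply_eq (n + 1) y z hyz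
    rw [hJ.apply_eq_taylor hxy hyz n, hJ.apply_eq_taylor hxy hyz (n + 1), map_add, map_add,
      map_smul, map_smul, h4, hJ.apply_eq_taylor hxy hyz (n + 1), mesh_eq_two_mul n, ← hs]
    module
  have hs' : ‖s ^ 2‖ = (mesh (n + 1) : ℝ) ^ 2 := by simp [hs]
  rw [e, modulus_smul, hs', mul_comm, mul_smul]
  refine smul_le_smul_of_nonneg_left ?_ (by positivity)
  have h5 : (7 : ℝ) • u = (2 : ℝ) • u + u + (4 : ℝ) • u := by module
  rw [h5]
  refine (modulus_sub_le _ _).trans (add_le_add ((modulus_add_le _ _).trans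
    (add_le_add ?_ h₃)) ?_)
  · rw [modulus_smul]
    simpa using smul_le_smul_of_nonneg_left h₂ (by norm_num : (0 : ℝ) ≤ 2)
  · rw [modulus_smul]
    simpa using smul_le_smul_of_nonneg_left h₁ (by norm_num : (0 : ℝ) ≤ 4)

/-- Stability and consistency: the error after `k` steps is at most `k` times the error of one. -/
theorem exists_modulus_pow_sub_pow_le (hJ : IsEulerFamily A J) {x y z : Complexification E}
    (hxy : (x, y) ∈ A.graph) (hyz : (y, z) ∈ A.graph) :
    ∃ w : E, 0 ≤ w ∧ ∀ n k : ℕ, modulus ((J (n + 1) ^ (2 * k)) x - (J n ^ k) x)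
      ≤ (k * (7 * (mesh (n + 1) : ℝ) ^ 2)) • w := by
  obtain ⟨u₀, -, hu₀⟩ := hJ.orderEquibounded.pointwise z
  obtain ⟨u, hu, h₀⟩ := hJ.orderEquibounded u₀
  obtain ⟨w, hw, h⟩ := hJ.orderEquibounded u
  refine ⟨w, hw, fun n k => ?_⟩
  have hz : ∀ m i j, modulus ((J m ^ i) ((J (n + 1) ^ j) z)) ≤ u := fun m i j => by
    simpa using h₀ (m, i) 1 _ zero_le_one (by simpa using hu₀ (n + 1, j))
  -- replace the coarse steps by pairs of fine steps, one at a time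
  have h1 := modulus_sub_le_of_step (f := fun j => (J n ^ (k - j)) ((J (n + 1) ^ (2 * j)) x))
    (c := fun _ => 7 * (mesh (n + 1) : ℝ) ^ 2) (v := w) (k := k) fun j hj => by
      obtain ⟨i, rfl⟩ := Nat.exists_eq_add_of_lt hj
      have e1 : j + i + 1 - j = i + 1 := by omega
      have e2 : j + i + 1 - (j + 1) = i := by omega
      have e3 : (J (n + 1) ^ (2 * (j + 1))) x
          = J (n + 1) (J (n + 1) ((J (n + 1) ^ (2 * j)) x)) := by
        rw [show 2 * (j + 1) = 2 * j + 1 + 1 by ring, pow_succ', pow_succ']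
        rfl
      rw [e1, e2, pow_succ (J n), Module.End.mul_apply, e3, ← map_sub]
      refine h (n, i) _ _ (by positivity) (hJ.modulus_sq_sub_le
        (hJ.pow_map_graph hxy (n + 1) (2 * j)) (hJ.pow_map_graph hyz (n + 1) (2 * j)) ?_ ?_ ?_)
      · simpa using hz n 1 (2 * j)
      · simpa using hz (n + 1) 1 (2 * j)
      · simpa [pow_two] using hz (n + 1) 2 (2 * j)
  simpa using h1

theorem floor_two_mul (t : ℝ≥0) (n : ℕ) :
    ⌊t * 2 ^ (n + 1)⌋₊ = 2 * ⌊t * 2 ^ n⌋₊ ∨ ⌊t * 2 ^ (n + 1)⌋₊ = 2 * ⌊t * 2 ^ n⌋₊ + 1 := by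
  have h1 : 2 * ⌊t * 2 ^ n⌋₊ ≤ ⌊t * 2 ^ (n + 1)⌋₊ := by
    refine Nat.le_floor ?_
    push_cast
    calc 2 * (⌊t * 2 ^ n⌋₊ : ℝ≥0) ≤ 2 * (t * 2 ^ n) := by gcongr; exact Nat.floor_le (by positivity)
      _ = t * 2 ^ (n + 1) := by ring
  have h2 : ⌊t * 2 ^ (n + 1)⌋₊ < 2 * ⌊t * 2 ^ n⌋₊ + 2 := by
    rw [Nat.floor_lt (by positivity)]
    push_cast
    calc t * 2 ^ (n + 1) = 2 * (t * 2 ^ n) := by ring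
      _ < 2 * (⌊t * 2 ^ n⌋₊ + 1) := by gcongr; exact Nat.lt_floor_add_one _
      _ = _ := by ring
  omega

theorem exists_modulus_step_le (hJ : IsEulerFamily A J) {x y z : Complexification E}
    (hxy : (x, y) ∈ A.graph) (hyz : (y, z) ∈ A.graph) (t : ℝ≥0) :
    ∃ w : E, 0 ≤ w ∧ ∀ n, modulus ((J (n + 1) ^ ⌊t * 2 ^ (n + 1)⌋₊) x - (J n ^ ⌊t * 2 ^ n⌋₊) x)
      ≤ (mesh n : ℝ) • w := by
  obtain ⟨w, hw, h⟩ := hJ.exists_modulus_pow_sub_pow_le hxy hyz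
  obtain ⟨u, hu, hyu⟩ := hJ.orderEquibounded.pointwise y
  refine ⟨(2 * t : ℝ) • w + u, add_nonneg (smul_nonneg (by positivity) hw) hu, fun n => ?_⟩
  set k := ⌊t * 2 ^ n⌋₊ with hk
  have hm : (mesh n : ℝ) = 2 * mesh (n + 1) := by exact_mod_cast mesh_eq_two_mul n
  have hkt : (k * mesh n : ℝ) ≤ t := by simpa using NNReal.coe_le_coe.2 (floor_mul_mesh_le t n)
  have hp : (0 : ℝ) ≤ mesh n := (mesh n).2
  have h1 : modulus ((J (n + 1) ^ (2 * k)) x - (J n ^ k) x) ≤ (mesh n * (2 * t) : ℝ) • w := by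
    refine (h n k).trans (smul_le_smul_of_nonneg_right ?_ hw)
    have e : (mesh (n + 1) : ℝ) = mesh n / 2 := by rw [hm]; ring
    rw [e]
    calc (k * (7 * (mesh n / 2) ^ 2) : ℝ) = 7 / 4 * (k * mesh n) * mesh n := by ring
      _ ≤ 7 / 4 * t * mesh n := by gcongr
      _ ≤ mesh n * (2 * t) := by nlinarith [mul_nonneg t.2 hp]
  rw [smul_add, smul_smul]
  rcases floor_two_mul t n with e | e
  · rw [e]
    exact h1.trans (le_add_of_nonneg_right (smul_nonneg hp hu))
  · rw [e]
    refine (modulus_sub_le_add _ ((J (n + 1) ^ (2 * k)) x) _).trans ?_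
    rw [add_comm]
    refine add_le_add h1 ?_
    rw [hJ.pow_succ_sub_pow hxy, modulus_smul]
    refine (smul_le_smul_of_nonneg_left (hyu (n + 1, 2 * k + 1)) (norm_nonneg _)).trans
      (smul_le_smul_of_nonneg_right ?_ hu)
    have := (mesh (n + 1)).2
    simp only [Complex.norm_real, NNReal.norm_eq]
    linarith

theorem sum_mesh_le (n d : ℕ) : ∑ j ∈ Finset.range d, (mesh (n + j) : ℝ) ≤ 2 * mesh n := by
  have key : ∑ j ∈ Finset.range d, (mesh (n + j) : ℝ) = 2 * mesh n - 2 * mesh (n + d) := by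
    induction d with
    | zero => simp
    | succ d ih =>
      have hm : (mesh (n + d) : ℝ) = 2 * mesh (n + d + 1) := by
        exact_mod_cast mesh_eq_two_mul (n + d)
      rw [Finset.sum_range_succ, ih, ← add_assoc, hm]
      ring
  rw [key]
  linarith [(mesh (n + d)).2]

/-- The approximants `J n ^ ⌊2ⁿ t⌋` converge: on the domain of `A²` by the error estimate, and
everywhere by property (D). -/
theorem exists_limit (hJ : IsEulerFamily A J) (hD : PropertyD E)
    (hA : RUDense (A.domain : Set (Complexification E))) (t : ℝ≥0) :
    ∃ S : Module.End ℂ (Complexification E), ∀ x,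
      RUTendsto (fun n => (J n ^ ⌊t * 2 ^ n⌋₊) x) atTop (S x) := by
  refine exists_limit_operator fun x => exists_ruTendsto_of_cauchy ?_
  let F : ℕ × ℕ → Module.End ℂ (Complexification E) := fun p =>
    J (p.1 + p.2) ^ ⌊t * 2 ^ (p.1 + p.2)⌋₊ - J p.1 ^ ⌊t * 2 ^ p.1⌋₊
  have hF : OrderEquibounded F :=
    (hJ.orderEquibounded.comp_index fun p : ℕ × ℕ => (p.1 + p.2, ⌊t * 2 ^ (p.1 + p.2)⌋₊)).sub
      (hJ.orderEquibounded.comp_index fun p : ℕ × ℕ => (p.1, ⌊t * 2 ^ p.1⌋₊))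
  have hsmall : ∀ x ∈ {x | ∃ y z, (x, y) ∈ A.graph ∧ (y, z) ∈ A.graph}, ∃ v : E, ∀ ε : ℝ,
      0 < ε → ∃ N : ℕ, ∀ n ≥ N, ∀ d, modulus (F (n, d) x) ≤ ε • v := by
    rintro x ⟨y, z, hxy, hyz⟩
    obtain ⟨w, hw, h⟩ := hJ.exists_modulus_step_le hxy hyz t
    refine ⟨(2 : ℝ) • w, fun ε hε => ?_⟩
    obtain ⟨N, hN⟩ := eventually_atTop.1
      ((tendsto_order.1 (NNReal.tendsto_coe.2 tendsto_mesh)).2 ε hε)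
    refine ⟨N, fun n hn d => ?_⟩
    have h1 := modulus_sub_le_of_step (f := fun j => (J (n + j) ^ ⌊t * 2 ^ (n + j)⌋₊) x)
      (c := fun j => (mesh (n + j) : ℝ)) (v := w) (k := d) fun j _ => h (n + j)
    refine h1.trans ?_
    rw [smul_smul]
    refine smul_le_smul_of_nonneg_right ((sum_mesh_le n d).trans ?_) hw
    linarith [hN n hn]
  obtain ⟨v, hv⟩ := hD.forall_of_ruDense hF (hJ.ruDense_domain_sq hD hA) hsmall x
  refine ⟨v, fun ε hε => ?_⟩
  obtain ⟨N, hN⟩ := hv ε hε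
  refine ⟨N, fun n hn => ?_⟩
  obtain ⟨d, rfl⟩ := Nat.exists_eq_add_of_le hn
  exact hN N le_rfl d

end IsEulerFamily

/-! ### The semigroup obtained from the Euler scheme -/

/-- The operators `T t` are the limits of the Euler scheme. -/
def IsEulerLimit (J : ℕ → Module.End ℂ (Complexification E))
    (T : ℝ≥0 → Complexification E →ₗ[ℂ] Complexification E) : Prop :=
  ∀ t x, RUTendsto (fun n => (J n ^ ⌊t * 2 ^ n⌋₊) x) atTop (T t x)

namespace IsEulerLimit

variable {T : ℝ≥0 → Complexification E →ₗ[ℂ] Complexification E}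

theorem positive (hT : IsEulerLimit J T) (hJ : IsEulerFamily A J) (t : ℝ≥0) :
    IsPositiveOperator (T t) := fun x hx =>
  (hT t x).isPos (Eventually.of_forall fun n => (hJ.positive n).pow _ x hx)

theorem exists_bound (hT : IsEulerLimit J T) (hJ : IsEulerFamily A J) (x : Complexification E) :
    ∃ v : E, ∀ t, modulus (T t x) ≤ v := by
  obtain ⟨v, hv⟩ := hJ.bounded x
  exact ⟨v, fun t => (hT t x).modulus_le (Eventually.of_forall fun n => hv n _)⟩

theorem map_zero (hT : IsEulerLimit J T) : T 0 = LinearMap.id :=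
  LinearMap.ext fun x => (hT 0 x).unique (by simpa using ruTendsto_const atTop x)

/-- The exponents `⌊2ⁿ s⌋ + ⌊2ⁿ t⌋` and `⌊2ⁿ (s + t)⌋` differ by at most one step, which is
negligible in the limit. -/
theorem map_add (hT : IsEulerLimit J T) (hJ : IsEulerFamily A J) (hD : PropertyD E)
    (hA : RUDense (A.domain : Set (Complexification E))) (s t : ℝ≥0) :
    T (s + t) = T t ∘ₗ T s := by
  refine LinearMap.ext fun x => ?_
  have h1 : RUTendsto (fun n => (J n ^ ⌊t * 2 ^ n⌋₊) ((J n ^ ⌊s * 2 ^ n⌋₊) x)) atTop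
      (T t (T s x)) :=
    hJ.orderEquibounded.ruTendsto (φ := fun n => (n, ⌊t * 2 ^ n⌋₊)) (hT s x) (hT t (T s x))
  obtain ⟨v, hv⟩ := hJ.exists_modulus_pow_sub_le hD hA x
  obtain ⟨w, hw, hvw⟩ := hJ.orderEquibounded v
  have h2 : RUTendsto (fun n => (J n ^ ⌊(s + t) * 2 ^ n⌋₊) x
      - (J n ^ ⌊t * 2 ^ n⌋₊) ((J n ^ ⌊s * 2 ^ n⌋₊) x)) atTop 0 := by
    refine ⟨w, fun ε hε => ?_⟩
    obtain ⟨δ, hδ, h⟩ := hv ε hε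
    filter_upwards [(tendsto_order.1 tendsto_mesh).2 δ hδ] with n hn
    rw [sub_zero, ← Module.End.mul_apply, ← pow_add, add_mul]
    have a1 : ⌊t * 2 ^ n⌋₊ + ⌊s * 2 ^ n⌋₊ ≤ ⌊s * 2 ^ n + t * 2 ^ n⌋₊ := by
      rw [add_comm]
      refine Nat.le_floor ?_
      push_cast
      exact add_le_add (Nat.floor_le (by positivity)) (Nat.floor_le (by positivity))
    have a2 : ⌊s * 2 ^ n + t * 2 ^ n⌋₊ ≤ ⌊t * 2 ^ n⌋₊ + ⌊s * 2 ^ n⌋₊ + 1 := by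
      rw [← Nat.lt_add_one_iff, Nat.floor_lt (by positivity)]
      have b1 := Nat.lt_floor_add_one (s * 2 ^ n)
      have b2 := Nat.lt_floor_add_one (t * 2 ^ n)
      push_cast
      calc s * 2 ^ n + t * 2 ^ n < (⌊s * 2 ^ n⌋₊ + 1) + (⌊t * 2 ^ n⌋₊ + 1) := add_lt_add b1 b2
        _ = _ := by ring
    rcases (by omega : ⌊s * 2 ^ n + t * 2 ^ n⌋₊ = ⌊t * 2 ^ n⌋₊ + ⌊s * 2 ^ n⌋₊ ∨
      ⌊s * 2 ^ n + t * 2 ^ n⌋₊ = ⌊t * 2 ^ n⌋₊ + ⌊s * 2 ^ n⌋₊ + 1) with e | e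
    · rw [e, sub_self, modulus_zero]
      exact smul_nonneg hε.le hw
    · rw [e, pow_succ, Module.End.mul_apply, ← map_sub]
      refine hvw (n, _) ε _ hε.le ?_
      simpa using h n 1 (by simpa using hn.le)
  have h3 := h2.add h1
  simp only [sub_add_cancel, zero_add] at h3
  exact (hT (s + t) x).unique h3

theorem exists_modulus_sub_le (hT : IsEulerLimit J T) (hJ : IsEulerFamily A J) (hD : PropertyD E)
    (hA : RUDense (A.domain : Set (Complexification E))) (x : Complexification E) :
    ∃ v : E, ∀ ε : ℝ, 0 < ε → ∃ δ : ℝ≥0, 0 < δ ∧ ∀ h ≤ δ, modulus (T h x - x) ≤ ε • v := by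
  obtain ⟨v, hv⟩ := hJ.exists_modulus_pow_sub_le hD hA x
  refine ⟨v, fun ε hε => ?_⟩
  obtain ⟨δ, hδ, h⟩ := hv ε hε
  exact ⟨δ, hδ, fun s hs => ((hT s x).sub (ruTendsto_const _ x)).modulus_le
    (Eventually.of_forall fun n => h n _ ((floor_mul_mesh_le s n).trans hs))⟩

theorem isPositiveRUCSemigroup (hT : IsEulerLimit J T) (hJ : IsEulerFamily A J)
    (hD : PropertyD E) (hA : RUDense (A.domain : Set (Complexification E))) :
    IsPositiveRUCSemigroup T where
  map_zero := hT.map_zero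
  map_add := hT.map_add hJ hD hA
  positive := hT.positive hJ
  ruContinuous_orbit x := by
    obtain ⟨v, hv⟩ := hT.exists_modulus_sub_le hJ hD hA x
    obtain ⟨w, hw, hvw⟩ :=
      OrderEquibounded.of_positive (hT.positive hJ) (hT.exists_bound hJ) v
    refine ⟨fun _ => w, fun ε hε => ?_⟩
    obtain ⟨δ, hδ, h⟩ := hv ε hε
    have key : ∀ s d : ℝ≥0, d ≤ δ → modulus (T (d + s) x - T s x) ≤ ε • w := by
      intro s d hd
      rw [hT.map_add hJ hD hA, LinearMap.comp_apply, ← _root_.map_sub]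
      exact hvw s ε _ hε.le (h d hd)
    refine ⟨δ, hδ, fun t s hst => ?_⟩
    rcases le_total t s with hle | hle
    · obtain ⟨d, rfl⟩ := exists_add_of_le hle
      rw [add_comm]
      refine key t d ?_
      rw [NNReal.coe_add, add_sub_cancel_left, NNReal.abs_eq] at hst
      exact hst
    · obtain ⟨d, rfl⟩ := exists_add_of_le hle
      rw [modulus_sub_comm, add_comm]
      refine key s d ?_
      rw [NNReal.coe_add, sub_add_cancel_left, abs_neg, NNReal.abs_eq] at hst
      exact hst

/-- The generator of the limit semigroup extends `A`. -/
theorem ruTendsto_quotient (hT : IsEulerLimit J T) (hJ : IsEulerFamily A J)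
    (hD : PropertyD E) (hA : RUDense (A.domain : Set (Complexification E)))
    {x y : Complexification E} (hxy : (x, y) ∈ A.graph) :
    RUTendsto (fun h : ℝ≥0 => ((h : ℂ)⁻¹) • (T h x - x)) (𝓝[>] 0) y := by
  obtain ⟨v, hv⟩ := hJ.exists_modulus_pow_sub_le hD hA y
  refine ⟨v, fun ε hε => ?_⟩
  obtain ⟨δ, hδ, hb⟩ := hv ε hε
  have hv0 : 0 ≤ ε • v := (modulus_nonneg _).trans (hb 0 0 (by simp))
  filter_upwards [self_mem_nhdsWithin, nhdsWithin_le_nhds (Iic_mem_nhds hδ)] with h hh hhδ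
  have hh0 : (h : ℂ) ≠ 0 := by simpa using (ne_of_gt hh : h ≠ 0)
  have hh1 : (h : ℝ) ≠ 0 := by simpa using (ne_of_gt hh : h ≠ 0)
  have hs : Tendsto (fun n : ℕ => ((⌊h * 2 ^ n⌋₊ * mesh n : ℝ≥0) : ℂ)) atTop (𝓝 (h : ℂ)) :=
    ((Complex.continuous_ofReal.comp NNReal.continuous_coe).tendsto h).comp
      (tendsto_floor_mul_mesh h)
  -- the integrated estimate `|T(h) x - x - h y| ≤ h ε v`, as a limit of discrete estimates
  have h1 : modulus (T h x - (h : ℂ) • y - x) ≤ (h : ℝ) • (ε • v) := by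
    refine (((hT h x).sub ((ruTendsto_const atTop y).smul hs)).sub
      (ruTendsto_const atTop x)).modulus_le (Eventually.of_forall fun n => ?_)
    have h2 := modulus_sub_le_of_step (k := ⌊h * 2 ^ n⌋₊) (v := ε • v)
      (f := fun j => (J n ^ j) x - ((j * mesh n : ℝ≥0) : ℂ) • y)
      (c := fun _ => (mesh n : ℝ)) fun j hj => by
        have e : (J n ^ (j + 1)) x - (((j + 1 : ℕ) * mesh n : ℝ≥0) : ℂ) • y
            - ((J n ^ j) x - ((j * mesh n : ℝ≥0) : ℂ) • y)
            = (mesh n : ℂ) • ((J n ^ (j + 1)) y - y) := by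
          rw [smul_sub, ← hJ.pow_succ_sub_pow hxy]
          push_cast
          module
        rw [e, modulus_smul]
        have hj' : ((j + 1 : ℕ) : ℝ≥0) ≤ ⌊h * 2 ^ n⌋₊ := by exact_mod_cast hj
        simpa using smul_le_smul_of_nonneg_left (hb n (j + 1)
          ((mul_le_mul_left hj' _).trans ((floor_mul_mesh_le h n).trans hhδ))) (mesh n).2
    have h3 : ((⌊h * 2 ^ n⌋₊ : ℝ) * mesh n) ≤ h := by
      simpa using NNReal.coe_le_coe.2 (floor_mul_mesh_le h n)
    refine le_trans ?_ (smul_le_smul_of_nonneg_right h3 hv0)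
    simpa using h2
  have e : ((h : ℂ)⁻¹) • (T h x - x) - y = ((h : ℂ)⁻¹) • (T h x - (h : ℂ) • y - x) := by
    rw [sub_right_comm, smul_sub _ (T h x - x), smul_smul, inv_mul_cancel₀ hh0, one_smul]
  rw [e, modulus_smul]
  refine (smul_le_smul_of_nonneg_left h1 (norm_nonneg _)).trans (le_of_eq ?_)
  simp [smul_smul, hh1]

end IsEulerLimit

theorem isEulerFamily_opResolvent
    (hres : ∀ r : ℝ, 0 < r → (r : ℂ) ∈ positiveResolventSet A)
    (hbound : ∀ x : Complexification E, ∃ v : E, ∀ (k : ℕ) (z : ℂ), 0 < z.re →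
      modulus ((opResolvent A z ^ k) x) ≤ ((z.re ^ k)⁻¹ : ℝ) • v) :
    IsEulerFamily A fun m => (mesh m : ℂ)⁻¹ • opResolvent A (mesh m : ℂ)⁻¹ := by
  have hpos : ∀ m, (0 : ℝ) < (mesh m : ℝ)⁻¹ := fun m => inv_pos.2 (mesh_pos m)
  have hne : ∀ m, (mesh m : ℂ) ≠ 0 := fun m => by simpa using (mesh_pos m).ne'
  have hR : ∀ m, (mesh m : ℂ)⁻¹ ∈ positiveResolventSet A := fun m => by
    simpa using hres _ (hpos m)
  refine ⟨fun m => ?_, fun x => ?_, fun m x y h => ?_, fun m x y h => ?_, fun m x => ?_⟩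
  · simpa using IsPositiveOperator.smul (hR m).2 (hpos m).le
  · obtain ⟨v, hv⟩ := hbound x
    refine ⟨v, fun m j => ?_⟩
    have hre : ((mesh m : ℂ)⁻¹).re = (mesh m : ℝ)⁻¹ := by
      rw [← Complex.ofReal_inv, Complex.ofReal_re]
    have h1 := hv j (mesh m : ℂ)⁻¹ (by rw [hre]; exact hpos m)
    rw [hre] at h1
    rw [smul_pow, LinearMap.smul_apply, modulus_smul]
    refine (smul_le_smul_of_nonneg_left h1 (norm_nonneg _)).trans (le_of_eq ?_)
    have := (mesh_pos m).ne'
    simp [smul_smul, this]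
  · have h1 := opResolvent_sub (hR m).1 h
    rw [map_sub, map_smul] at h1
    simp only [LinearMap.smul_apply, smul_smul, mul_inv_cancel₀ (hne m), one_smul]
    exact sub_eq_iff_eq_add.1 h1
  · have h1 := opResolvent_sub (hR m).1 h
    have h2 := opResolvent_mem_graph (hR m).1 x
    rw [map_sub, map_smul, sub_eq_iff_eq_add, add_comm, ← sub_eq_iff_eq_add] at h1
    rw [h1] at h2
    exact A.graph.smul_mem (mesh m : ℂ)⁻¹ h2
  · exact A.graph.smul_mem (mesh m : ℂ)⁻¹ (opResolvent_mem_graph (hR m).1 x)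

end Euler

end RUSemigroup

open RUSemigroup

theorem mainTheorem1 {E : Type*} [AddCommGroup E] [Lattice E] [IsOrderedAddMonoid E]
    [Module ℝ E] [IsOrderedModule ℝ E] [RUSemigroup.IsArchimedean E]
    [RUSemigroup.IsRUComplete E] (hD : RUSemigroup.PropertyD E)
    (A : RUSemigroup.Complexification E →ₗ.[ℂ] RUSemigroup.Complexification E) :
    (∃ T : ℝ≥0 → RUSemigroup.Complexification E →ₗ[ℂ] RUSemigroup.Complexification E,
      RUSemigroup.IsPositiveRUCSemigroup T ∧ RUSemigroup.IsExpOrderBounded T 0 ∧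
        RUSemigroup.IsGenerator A T) ↔
    (RUSemigroup.RUClosed A ∧
      RUSemigroup.RUDense (A.domain : Set (RUSemigroup.Complexification E)) ∧
      {z : ℂ | 0 < z.re} ⊆ RUSemigroup.opResolventSet A ∧
      (∀ r : ℝ, 0 < r → (r : ℂ) ∈ RUSemigroup.positiveResolventSet A) ∧
      ∀ x : RUSemigroup.Complexification E, ∃ v : E, ∀ (k : ℕ) (z : ℂ), 0 < z.re →
        RUSemigroup.Complexification.modulus ((RUSemigroup.opResolvent A z ^ k) x)
          ≤ ((z.re ^ k)⁻¹ : ℝ) • v) := by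
  constructor
  · rintro ⟨T, hT, hb, hA⟩
    refine ⟨hA.ruClosed hT hb, hA.ruDense_domain hT hb,
      fun z hz => (hA.exists_resolvent hT hb hz).1, fun r hr => ?_, fun x => ?_⟩
    · obtain ⟨h1, h2⟩ := hA.exists_resolvent hT hb (z := (r : ℂ)) (by simpa using hr)
      exact ⟨h1, h2.positive (by simp)⟩
    · obtain ⟨v, hv⟩ := hb.exists_bound x
      refine ⟨v, fun k z hz => ?_⟩
      have h := (hA.exists_resolvent hT hb hz).2.modulus_pow_le hT hv k 0
      rwa [hT.map_zero] at h
  · rintro ⟨-, hA, -, hres, hbound⟩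
    have hJ := isEulerFamily_opResolvent hres hbound
    choose T hTlim using hJ.exists_limit hD hA
    have hlim : IsEulerLimit _ T := hTlim
    have hT := hlim.isPositiveRUCSemigroup hJ hD hA
    have hb : IsExpOrderBounded T 0 := fun x => by
      obtain ⟨v, hv⟩ := hlim.exists_bound hJ x
      exact ⟨v, fun t => by simpa using hv t⟩
    refine ⟨T, hT, hb, fun x y => ⟨?_, fun h => ?_⟩⟩
    · rintro ⟨hx, rfl⟩
      exact hlim.ruTendsto_quotient hJ hD hA (A.mem_graph ⟨x, hx⟩)
    · -- `1 - A` is onto and the generator of `T` extends `A`, so injectivity of `1` minus the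
      -- generator leaves no room for a proper extension.
      obtain ⟨R, hR⟩ := exists_isLaplaceTransform hT hb (z := 1) (by simp)
      have h1 : (1 : ℂ) ∈ opResolventSet A := by simpa using (hres 1 one_pos).1
      have h2 := opResolvent_mem_graph h1 ((1 : ℂ) • x - y)
      have h3 := hR.apply_sub hT hb (by simp) (hlim.ruTendsto_quotient hJ hD hA h2)
      rw [sub_sub_cancel, hR.apply_sub hT hb (by simp) h] at h3
      rw [← h3, one_smul, sub_sub_cancel] at h2
      obtain ⟨a, rfl, ha⟩ := A.mem_graph_iff.1 h2
      exact ⟨a.2, ha⟩
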